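/- **Theorem 5.** Let $v:\mathbb R^3\to\mathbb R$ be an even (measurable) potential, $T\ge 0$, and let $\phi(t,x)$ be a complex-valued (measurable) function (in the application, a smooth solution of the Hartree equation $i\phi_t+\Delta\phi-(v*|\phi|^2)\phi=0$; this equation is not needed here). Put $$m(t,x,y)=-v(x-y)\overline{\phi}(t,x)\overline{\phi}(t,y),\qquad g(t,x,y)=-\Delta_x\delta(x-y)+v(x-y)\phi(t,x)\overline{\phi}(t,y)+(v*|\phi|^2)(t,x)\,\delta(x-y),$$ and assume $m\in L^1([0,T];L^2(\mathbb R^3\times\mathbb R^3))$ and $v*|\phi|^2\in L^1([0,T];L^\infty(\mathbb R^3))$, the convolution integral converging absolutely for almost every $(t,x)$. Products of kernels denote composition, $(ab)(x,y)=\int a(x,z)b(z,y)\,dz$, and $g^T(x,y)=g(y,x)$. For each $t\in[0,T]$ let $k(t)\in L^2(\mathbb R^3\times\mathbb R^3)$ be a symmetric kernel, and put $$u=\mathrm{sh}(k)=k+\tfrac1{3!}k\overline kk+\cdots,\qquad 1+p=\mathrm{ch}(k)=1+\tfrac1{2!}k\overline k+\cdots .$$ Suppose that $u$ is a solution on $[0,T]$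 of $$iu_t+ug^T+gu-(1+p)m=\bigl(ip_t+[g,p]+u\overline m\bigr)(1+p)^{-1}u ,$$ in the following sense: $u\in C([0,T];L^2(\mathbb R^3\times\mathbb R^3))$, the distributions $iu_t+gu+ug^T$ and $ip_t+[g,p]$ belong to $L^1([0,T];L^2(\mathbb R^3\times\mathbb R^3))$, and the equation holds for almost every $t\in[0,T]$. Then $$\|u(T)\|_{L^2}\le\Bigl(\int_0^T\|m(t)\|_{L^2}\,dt+\|u(0)\|_{L^2}\Bigr)\exp\Bigl(\int_0^T\|m(t)\|_{L^2}\,dt\Bigr),$$ where all norms are those of $L^2(\mathbb R^3\times\mathbb R^3)$. -/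

import Mathlib

open MeasureTheory Set
open scoped ENNReal ContDiff

noncomputable section

namespace PairExcitation

/-- The physical space `ℝ³`. -/
abbrev E := EuclideanSpace ℝ (Fin 3)

/-- Hilbert-Schmidt kernels: the Hilbert space `L²(ℝ³ × ℝ³; ℂ)`. Complex conjugation is `star`. -/
abbrev L2 := Lp ℂ 2 (volume : Measure (E × E))

/-! ### Composition of kernels -/

/-- Composition of kernels, `(a ∘ b)(x, y) = ∫ a(x, z) b(z, y) dz`. -/
def compFun (a b : E × E → ℂ) : E × E → ℂ :=
  fun q => ∫ z, a (q.1, z) * b (z, q.2)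

theorem enorm_pow_two (a : L2) : ‖a‖ₑ ^ 2 = ∫⁻ q, ‖a q‖ₑ ^ 2 := by
  have h := eLpNorm_nnreal_pow_eq_lintegral (f := (a : E × E → ℂ)) (p := 2)
    (μ := (volume : Measure (E × E))) (by norm_num)
  rw [Lp.enorm_def]
  simpa using h

theorem aux_meas (a b : L2) : Measurable
    (fun s : (E × E) × E => ‖a (s.1.1, s.2)‖ₑ * ‖b (s.2, s.1.2)‖ₑ) := by
  have ha := (Lp.stronglyMeasurable a).measurable
  have hb := (Lp.stronglyMeasurable b).measurable
  fun_prop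

theorem lintegral_comp_le (a b : L2) :
    ∫⁻ q : E × E, (∫⁻ z, ‖a (q.1, z)‖ₑ * ‖b (z, q.2)‖ₑ) ^ 2 ≤ ‖a‖ₑ ^ 2 * ‖b‖ₑ ^ 2 := by
  have ha := (Lp.stronglyMeasurable a).measurable
  have hb := (Lp.stronglyMeasurable b).measurable
  have key : ∀ q : E × E, (∫⁻ z, ‖a (q.1, z)‖ₑ * ‖b (z, q.2)‖ₑ) ^ 2
      ≤ (∫⁻ z, ‖a (q.1, z)‖ₑ ^ 2) * (∫⁻ z, ‖b (z, q.2)‖ₑ ^ 2) := by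
    intro q
    have h := ENNReal.lintegral_mul_le_Lp_mul_Lq (volume : Measure E)
      Real.HolderConjugate.two_two (f := fun z => ‖a (q.1, z)‖ₑ) (g := fun z => ‖b (z, q.2)‖ₑ)
      (by fun_prop) (by fun_prop)
    simp only [Pi.mul_apply, ENNReal.rpow_two] at h
    refine (pow_le_pow_left' h 2).trans (le_of_eq ?_)
    rw [mul_pow, ← ENNReal.rpow_two, ← ENNReal.rpow_two, ← ENNReal.rpow_mul, ← ENNReal.rpow_mul]
    norm_num
  refine (lintegral_mono key).trans (le_of_eq ?_)
  have hA : Measurable fun x : E => ∫⁻ z, ‖a (x, z)‖ₑ ^ 2 := by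
    apply Measurable.lintegral_prod_right'
      (f := fun s : E × E => ‖a (s.1, s.2)‖ₑ ^ 2)
    fun_prop
  have hB : Measurable fun y : E => ∫⁻ z, ‖b (z, y)‖ₑ ^ 2 := by
    apply Measurable.lintegral_prod_right'
      (f := fun s : E × E => ‖b (s.2, s.1)‖ₑ ^ 2)
    fun_prop
  have h1 := lintegral_prod_mul (μ := (volume : Measure E)) (ν := (volume : Measure E))
    hA.aemeasurable hB.aemeasurable
  have h2 := lintegral_prod (μ := (volume : Measure E)) (ν := (volume : Measure E))
    (fun q : E × E => ‖a q‖ₑ ^ 2) (by fun_prop)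
  have h3 := lintegral_prod_symm (μ := (volume : Measure E)) (ν := (volume : Measure E))
    (fun q : E × E => ‖b q‖ₑ ^ 2) (by fun_prop)
  rw [enorm_pow_two, enorm_pow_two]
  exact h1.trans (congrArg₂ (· * ·) h2.symm h3.symm)

theorem enorm_compFun_le (a b : L2) (q : E × E) :
    ‖compFun a b q‖ₑ ≤ ∫⁻ z, ‖a (q.1, z)‖ₑ * ‖b (z, q.2)‖ₑ := by
  refine (enorm_integral_le_lintegral_enorm _).trans (le_of_eq ?_)
  simp only [enorm_mul]

theorem stronglyMeasurable_compFun (a b : L2) : StronglyMeasurable (compFun a b) := by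
  have ha := (Lp.stronglyMeasurable a).measurable
  have hb := (Lp.stronglyMeasurable b).measurable
  have h : StronglyMeasurable (fun s : (E × E) × E => a (s.1.1, s.2) * b (s.2, s.1.2)) :=
    Measurable.stronglyMeasurable (by fun_prop)
  exact h.integral_prod_right'

theorem eLpNorm_compFun_le (a b : L2) : eLpNorm (compFun a b) 2 volume ≤ ‖a‖ₑ * ‖b‖ₑ := by
  have h := eLpNorm_nnreal_pow_eq_lintegral (f := compFun a b) (p := 2)
    (μ := (volume : Measure (E × E))) (by norm_num)
  have h2 : eLpNorm (compFun a b) 2 volume ^ 2 = ∫⁻ q, ‖compFun a b q‖ₑ ^ 2 := by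
    simpa using h
  have h3 : eLpNorm (compFun a b) 2 volume ^ 2 ≤ (‖a‖ₑ * ‖b‖ₑ) ^ 2 := by
    rw [h2, mul_pow]
    exact (lintegral_mono fun q => pow_le_pow_left' (enorm_compFun_le a b q) 2).trans
      (lintegral_comp_le a b)
  exact (ENNReal.pow_le_pow_left_iff (by norm_num)).1 h3

theorem memLp_compFun (a b : L2) : MemLp (compFun a b) 2 volume :=
  ⟨(stronglyMeasurable_compFun a b).aestronglyMeasurable,
    (eLpNorm_compFun_le a b).trans_lt (ENNReal.mul_lt_top enorm_lt_top enorm_lt_top)⟩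

/-- Composition of kernels as an operation on `L²(ℝ³ × ℝ³)`. -/
def comp (a b : L2) : L2 := (memLp_compFun a b).toLp

theorem coeFn_comp (a b : L2) : comp a b =ᵐ[volume] compFun a b := MemLp.coeFn_toLp _

theorem norm_comp_le (a b : L2) : ‖comp a b‖ ≤ ‖a‖ * ‖b‖ := by
  have h : ‖comp a b‖ₑ ≤ ‖a‖ₑ * ‖b‖ₑ := by
    rw [comp, Lp.enorm_toLp]
    exact eLpNorm_compFun_le a b
  have h' := ENNReal.toReal_mono (ENNReal.mul_lt_top enorm_lt_top enorm_lt_top).ne h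
  simpa [ENNReal.toReal_mul] using h'

theorem ae_integrable_comp (a b : L2) :
    ∀ᵐ q : E × E, Integrable fun z => a (q.1, z) * b (z, q.2) := by
  have ha := (Lp.stronglyMeasurable a).measurable
  have hb := (Lp.stronglyMeasurable b).measurable
  have hm : Measurable fun q : E × E => (∫⁻ z, ‖a (q.1, z)‖ₑ * ‖b (z, q.2)‖ₑ) ^ 2 :=
    (Measurable.lintegral_prod_right' (aux_meas a b)).pow_const 2
  have hfin : ∫⁻ q : E × E, (∫⁻ z, ‖a (q.1, z)‖ₑ * ‖b (z, q.2)‖ₑ) ^ 2 ≠ ⊤ :=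
    ((lintegral_comp_le a b).trans_lt (ENNReal.mul_lt_top
      (ENNReal.pow_lt_top enorm_lt_top) (ENNReal.pow_lt_top enorm_lt_top))).ne
  filter_upwards [ae_lt_top hm hfin] with q hq
  refine ⟨(Measurable.aestronglyMeasurable (by fun_prop)), ?_⟩
  have : (∫⁻ z, ‖a (q.1, z)‖ₑ * ‖b (z, q.2)‖ₑ) < ⊤ := by
    by_contra hc
    rw [not_lt, top_le_iff] at hc
    simp [hc] at hq
  simpa [HasFiniteIntegral, enorm_mul] using this

theorem ae_slice {f g : E × E → ℂ} (h : f =ᵐ[volume] g) :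
    ∀ᵐ q : E × E, ∀ᵐ z : E, f (z, q.2) = g (z, q.2) := by
  have h1 : ∀ᵐ s : E × E, f s.swap = g s.swap :=
    (Measure.measurePreserving_swap (μ := (volume : Measure E))
      (ν := (volume : Measure E))).quasiMeasurePreserving.ae h
  have h2 : ∀ᵐ y : E, ∀ᵐ z : E, f (z, y) = g (z, y) := Measure.ae_ae_of_ae_prod h1
  exact (Measure.quasiMeasurePreserving_snd (μ := (volume : Measure E))
    (ν := (volume : Measure E))).ae h2

/-- Left composition with a kernel, as a bounded operator on `L²(ℝ³ × ℝ³)`. -/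
def compLeft (a : L2) : L2 →L[ℂ] L2 :=
  LinearMap.mkContinuous
    { toFun := comp a
      map_add' := by
        intro b c
        apply Lp.ext
        filter_upwards [coeFn_comp a (b + c), coeFn_comp a b, coeFn_comp a c,
          Lp.coeFn_add (comp a b) (comp a c), ae_integrable_comp a b, ae_integrable_comp a c,
          ae_slice (Lp.coeFn_add b c)]
          with q h1 h2 h3 h4 h5 h6 h7
        rw [h1, h4, Pi.add_apply, h2, h3]
        simp only [compFun]
        rw [← integral_add h5 h6]
        refine integral_congr_ae ?_
        filter_upwards [h7] with z hz
        rw [hz, Pi.add_apply, mul_add]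
      map_smul' := by
        intro r b
        apply Lp.ext
        filter_upwards [coeFn_comp a (r • b), coeFn_comp a b, Lp.coeFn_smul r (comp a b),
          ae_slice (Lp.coeFn_smul r b)] with q h1 h2 h3 h4
        rw [RingHom.id_apply, h1, h3, Pi.smul_apply, h2]
        simp only [compFun]
        rw [smul_eq_mul, ← integral_const_mul]
        refine integral_congr_ae ?_
        filter_upwards [h4] with z hz
        rw [hz, Pi.smul_apply, smul_eq_mul]
        ring }
    ‖a‖ (norm_comp_le a)

/-- The transposed kernel `aᵀ(x, y) = a(y, x)`. -/
def transpose (a : L2) : L2 :=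
  Lp.compMeasurePreserving Prod.swap
    (Measure.measurePreserving_swap (μ := (volume : Measure E)) (ν := (volume : Measure E))) a

/-! ### Hyperbolic functions of a kernel -/

/-- `shTerm k n = k (k̄ k)ⁿ = (k k̄)ⁿ k`. -/
def shTerm (k : L2) : ℕ → L2
  | 0 => k
  | n + 1 => comp (comp k (star k)) (shTerm k n)

/-- `chTerm k n = (k k̄)ⁿ⁺¹`. -/
def chTerm (k : L2) : ℕ → L2
  | 0 => comp k (star k)
  | n + 1 => comp (comp k (star k)) (chTerm k n)

/-- `sh(k) = k + (1/3!) k k̄ k + …`, a norm-convergent series in `L²(ℝ³ × ℝ³)`. -/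
def sh (k : L2) : L2 := ∑' n : ℕ, (((2 * n + 1).factorial : ℂ)⁻¹) • shTerm k n

/-- `p = ch(k) - 1 = (1/2!) k k̄ + (1/4!) k k̄ k k̄ + …`, a norm-convergent series in
`L²(ℝ³ × ℝ³)`. -/
def chSubOne (k : L2) : L2 := ∑' n : ℕ, (((2 * n + 2).factorial : ℂ)⁻¹) • chTerm k n

theorem norm_star_L2 (a : L2) : ‖star a‖ = ‖a‖ := by
  refine le_antisymm (Lp.norm_le_norm_of_ae_le ?_) (Lp.norm_le_norm_of_ae_le ?_)
  all_goals filter_upwards [Lp.coeFn_star a] with q hq using by simp [hq]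

theorem norm_shTerm_le (k : L2) (n : ℕ) : ‖shTerm k n‖ ≤ ‖k‖ ^ (2 * n + 1) := by
  induction n with
  | zero => simp [shTerm]
  | succ n ih =>
    calc ‖shTerm k (n + 1)‖ ≤ ‖comp k (star k)‖ * ‖shTerm k n‖ := norm_comp_le _ _
      _ ≤ (‖k‖ * ‖star k‖) * ‖k‖ ^ (2 * n + 1) := by gcongr; exact norm_comp_le _ _
      _ = ‖k‖ ^ (2 * (n + 1) + 1) := by rw [norm_star_L2]; ring

theorem norm_chTerm_le (k : L2) (n : ℕ) : ‖chTerm k n‖ ≤ ‖k‖ ^ (2 * n + 2) := by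
  induction n with
  | zero =>
    calc ‖chTerm k 0‖ ≤ ‖k‖ * ‖star k‖ := norm_comp_le _ _
      _ = ‖k‖ ^ (2 * 0 + 2) := by rw [norm_star_L2]; ring
  | succ n ih =>
    calc ‖chTerm k (n + 1)‖ ≤ ‖comp k (star k)‖ * ‖chTerm k n‖ := norm_comp_le _ _
      _ ≤ (‖k‖ * ‖star k‖) * ‖k‖ ^ (2 * n + 2) := by gcongr; exact norm_comp_le _ _
      _ = ‖k‖ ^ (2 * (n + 1) + 2) := by rw [norm_star_L2]; ring

theorem summable_sh (k : L2) :
    Summable fun n : ℕ => (((2 * n + 1).factorial : ℂ)⁻¹) • shTerm k n := by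
  have h := (Real.summable_pow_div_factorial ‖k‖).comp_injective
    (i := fun n : ℕ => 2 * n + 1) (fun a b h => by simpa using h)
  refine Summable.of_norm_bounded h fun n => ?_
  rw [norm_smul, norm_inv, Complex.norm_natCast, Function.comp_apply, div_eq_inv_mul]
  gcongr
  exact norm_shTerm_le k n

theorem summable_ch (k : L2) :
    Summable fun n : ℕ => (((2 * n + 2).factorial : ℂ)⁻¹) • chTerm k n := by
  have h := (Real.summable_pow_div_factorial ‖k‖).comp_injective
    (i := fun n : ℕ => 2 * n + 2) (fun a b h => by simpa using h)
  refine Summable.of_norm_bounded h fun n => ?_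
  rw [norm_smul, norm_inv, Complex.norm_natCast, Function.comp_apply, div_eq_inv_mul]
  gcongr
  exact norm_chTerm_le k n

/-- The composition `(1 + p)⁻¹ u`: the inverse of the bounded operator `z ↦ z + p z`
of `L²(ℝ³ × ℝ³)`, applied to `u`. -/
def invOneAdd (p u : L2) : L2 := Ring.inverse (1 + compLeft p) u

/-! ### The coefficients of the equation -/

/-- A function on `ℝ³ × ℝ³` as an element of `L²` (and `0` if it is not square-integrable). -/
def toL2 (f : E × E → ℂ) : L2 :=
  open Classical in if h : MemLp f 2 (volume : Measure (E × E)) then h.toLp else 0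

/-- `m(t, x, y) = - v(x - y) φ̄(t, x) φ̄(t, y)`. -/
def mFun (v : E → ℝ) (φ : ℝ → E → ℂ) (t : ℝ) : E × E → ℂ :=
  fun q => -((v (q.1 - q.2) : ℂ) * star (φ t q.1) * star (φ t q.2))

/-- `w(t, x, y) = v(x - y) φ(t, x) φ̄(t, y)`. -/
def wFun (v : E → ℝ) (φ : ℝ → E → ℂ) (t : ℝ) : E × E → ℂ :=
  fun q => (v (q.1 - q.2) : ℂ) * φ t q.1 * star (φ t q.2)

/-- The kernel `m(t)` in `L²(ℝ³ × ℝ³)`. -/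
def mKer (v : E → ℝ) (φ : ℝ → E → ℂ) (t : ℝ) : L2 := toL2 (mFun v φ t)

/-- The kernel `w(t)` in `L²(ℝ³ × ℝ³)`; it has the same modulus as `m(t)`. -/
def wKer (v : E → ℝ) (φ : ℝ → E → ℂ) (t : ℝ) : L2 := toL2 (wFun v φ t)

/-- The mean-field potential `(v * |φ|²)(t, x)`. -/
def meanField (v : E → ℝ) (φ : ℝ → E → ℂ) (t : ℝ) (x : E) : ℝ :=
  ∫ y, v (x - y) * ‖φ t y‖ ^ 2

/-! ### Weak form of the operators `S` and `W`

Here `g = -Δ + w + v * |φ|²`, so that `g a`, `a g` and `a gᵀ` are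
`-Δ_x a + w a + (v * |φ|²)(x) a`, `-Δ_y a + a w + (v * |φ|²)(y) a` and
`-Δ_y a + a wᵀ + (v * |φ|²)(y) a`. -/

/-- Test functions: smooth, compactly supported functions on `ℝ³ × ℝ³`. -/
def IsTest (ψ : E × E → ℂ) : Prop := ContDiff ℝ ∞ ψ ∧ HasCompactSupport ψ

/-- `Δ_x ψ`. -/
def lapX (ψ : E × E → ℂ) : E × E → ℂ := fun q => (Laplacian.laplacian (fun x : E => ψ (x, q.2))) q.1

/-- `Δ_y ψ`. -/
def lapY (ψ : E × E → ℂ) : E × E → ℂ := fun q => (Laplacian.laplacian (fun y : E => ψ (q.1, y))) q.2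

/-- The bilinear pairing `∫∫ a(x, y) ψ(x, y) dx dy`. -/
def pair (a : L2) (ψ : E × E → ℂ) : ℂ := ∫ q, a q * ψ q

/-- `S(u) := i u_t + g u + u gᵀ = G` on `[0, T]`, in the sense of distributions
(tested in space, integrated in time). -/
def IsS (v : E → ℝ) (φ : ℝ → E → ℂ) (T : ℝ) (u G : ℝ → L2) : Prop :=
  ∀ ψ : E × E → ℂ, IsTest ψ → ∀ t ∈ Icc 0 T,
    Complex.I * (pair (u t) ψ - pair (u 0) ψ)
      + ∫ s in (0 : ℝ)..t,
          (pair (u s) (fun q => -lapX ψ q - lapY ψ q)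
            + pair (comp (wKer v φ s) (u s) + comp (u s) (transpose (wKer v φ s))) ψ
            + pair (u s) (fun q => ((meanField v φ s q.1 + meanField v φ s q.2 : ℝ) : ℂ) * ψ q))
      = ∫ s in (0 : ℝ)..t, pair (G s) ψ

/-- `W(p) := i p_t + [g, p] = F` on `[0, T]`, in the sense of distributions
(tested in space, integrated in time). -/
def IsW (v : E → ℝ) (φ : ℝ → E → ℂ) (T : ℝ) (p F : ℝ → L2) : Prop :=
  ∀ ψ : E × E → ℂ, IsTest ψ → ∀ t ∈ Icc 0 T,
    Complex.I * (pair (p t) ψ - pair (p 0) ψ)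
      + ∫ s in (0 : ℝ)..t,
          (pair (p s) (fun q => -lapX ψ q + lapY ψ q)
            + pair (comp (wKer v φ s) (p s) - comp (p s) (wKer v φ s)) ψ
            + pair (p s) (fun q => ((meanField v φ s q.1 - meanField v φ s q.2 : ℝ) : ℂ) * ψ q))
      = ∫ s in (0 : ℝ)..t, pair (F s) ψ

/-- `u = sh(k)`, with `1 + p = ch(k)` and `k(t)` symmetric, is a solution on `[0, T]` of
`i u_t + u gᵀ + g u - (1 + p) m = (i p_t + [g, p] + u m̄) (1 + p)⁻¹ u`:
`u` is continuous in time with values in `L²(ℝ³ × ℝ³)`, the distributions `W(p) = i p_t + [g, p]`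
and `S(u) = i u_t + g u + u gᵀ` are given by functions `F` and `G` in `L¹([0, T]; L²)`, and the
equation holds in `L²(ℝ³ × ℝ³)` for almost every time. -/
structure IsSolution (v : E → ℝ) (φ : ℝ → E → ℂ) (T : ℝ) (k : ℝ → L2) : Prop where
  symm : ∀ t ∈ Icc 0 T, transpose (k t) = k t
  cont : ContinuousOn (fun t => sh (k t)) (Icc 0 T)
  eqn : ∃ F G : ℝ → L2, IntegrableOn F (Icc 0 T) ∧ IntegrableOn G (Icc 0 T) ∧
    IsW v φ T (fun t => chSubOne (k t)) F ∧
    IsS v φ T (fun t => sh (k t)) G ∧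
    ∀ᵐ t ∂(volume.restrict (Icc 0 T)),
      G t - (mKer v φ t + comp (chSubOne (k t)) (mKer v φ t))
        = comp (F t + comp (sh (k t)) (star (mKer v φ t)))
            (invOneAdd (chSubOne (k t)) (sh (k t)))

end PairExcitation

end

open PairExcitation

/-!
Put `c = 1 + p = ch(k)`, so that `c² = 1 + u u*`. Inserting this identity into the two
Schrödinger-type equations satisfied by `p` and `u` gives `F c + c F = G u* - u G*`, where
`F = i p_t + [g, p]` is skew-adjoint and `G = i u_t + g u + u gᵀ`. Put `A = (F + u m̄) c⁻¹`, so that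
the equation reads `G = c m + A u`. Substituting `F = A c - u m̄` and this `G` leaves
`A (c² - u u*) = (c² - u u*) A*`, that is, `A = A*`. Hence `⟨u, A u⟩` is real and
`½ d/dt ‖u‖² = Im ⟨u, G⟩ = Im ⟨u, c m⟩ ≤ ‖u‖ (1 + ‖u‖) ‖m‖`, because `‖c‖² = ‖c²‖ ≤ (1 + ‖u‖)²`.
A Gronwall argument gives `1 + ‖u(T)‖ ≤ (1 + ‖u(0)‖) e^M` with `M = ∫ ‖m‖`, and `1 - M ≤ e^{-M}`.

The kernels are only weak solutions, so products and norms are differentiated after mollification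
by even functions in each variable: mollified kernels are absolutely continuous in time, the
Laplacian falls on the mollifier, and in the end the mollifier is removed.
-/

open MeasureTheory Set Filter
open scoped ENNReal ContDiff Topology
open Finset.HasAntidiagonal (antidiagonal mem_antidiagonal)

noncomputable section

namespace PairExcitation

section Slices

variable {X Y : Type*} [MeasureSpace X] [SFinite (volume : Measure X)]

theorem measurePreserving_swap : MeasurePreserving (Prod.swap : X × X → X × X) :=
  Measure.measurePreserving_swap

theorem ae_swap {P : X × X → Prop} (h : ∀ᵐ q, P q) : ∀ᵐ q : X × X, P q.swap :=
  measurePreserving_swap.quasiMeasurePreserving.ae h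

theorem ae_slice_left {f g : X × X → Y} (h : f =ᵐ[volume] g) :
    ∀ᵐ q : X × X, ∀ᵐ z, f (q.1, z) = g (q.1, z) :=
  Measure.quasiMeasurePreserving_fst.ae (Measure.ae_ae_of_ae_prod h)

theorem ae_slice_right {P : X × X → Prop} (h : ∀ᵐ q, P q) : ∀ᵐ q : X × X, ∀ᵐ z, P (z, q.2) :=
  Measure.quasiMeasurePreserving_snd.ae (Measure.ae_ae_of_ae_prod (ae_swap h))

/-- The exchange of the first and third points of a triple `((x, y), z)`. -/
def swapOuter : (X × X) × X ≃ᵐ (X × X) × X :=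
  MeasurableEquiv.prodAssoc.trans
    (((MeasurableEquiv.refl X).prodCongr MeasurableEquiv.prodComm).trans MeasurableEquiv.prodComm)

theorem measurePreserving_swapOuter : MeasurePreserving (swapOuter (X := X)) :=
  Measure.measurePreserving_swap.comp
    (((MeasurePreserving.id volume).prod Measure.measurePreserving_swap).comp
      (measurePreserving_prodAssoc volume volume volume))

theorem integral_integral_swapOuter {F : (X × X) × X → ℂ} (hF : Integrable F) :
    ∫ q, ∫ z, F (q, z) = ∫ q : X × X, ∫ x, F ((x, q.2), q.1) := by
  have h_comp := measurePreserving_swapOuter.integral_comp' F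
  have hF' := (measurePreserving_swapOuter.integrable_comp_emb
    swapOuter.measurableEmbedding).2 hF
  exact ((integral_prod F hF).symm.trans h_comp.symm).trans (integral_prod _ hF')

end Slices

/-! ### The algebra of Hilbert–Schmidt kernels -/

theorem comp_ae_eq {a b : L2} {f g : E × E → ℂ} (ha : a =ᵐ[volume] f) (hb : b =ᵐ[volume] g) :
    comp a b =ᵐ[volume] compFun f g := by
  filter_upwards [coeFn_comp a b, ae_slice_left ha, ae_slice hb] with q h h₁ h₂
  rw [h]
  refine integral_congr_ae ?_
  filter_upwards [h₁, h₂] with z hz₁ hz₂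
  rw [hz₁, hz₂]

theorem compLeft_apply (a b : L2) : compLeft a b = comp a b := rfl

theorem comp_add_right (a b c : L2) : comp a (b + c) = comp a b + comp a c :=
  (compLeft a).map_add b c

theorem comp_smul_right (r : ℂ) (a b : L2) : comp a (r • b) = r • comp a b :=
  (compLeft a).map_smul r b

theorem coeFn_transpose (a : L2) : transpose a =ᵐ[volume] fun q => a q.swap :=
  Lp.coeFn_compMeasurePreserving _ _

theorem norm_transpose (a : L2) : ‖transpose a‖ = ‖a‖ := Lp.norm_compMeasurePreserving _ _

theorem transpose_transpose (a : L2) : transpose (transpose a) = a := by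
  apply Lp.ext
  filter_upwards [coeFn_transpose (transpose a), ae_swap (coeFn_transpose a)] with q h₁ h₂
  rw [h₁, h₂, Prod.swap_swap]

theorem transpose_smul (r : ℂ) (a : L2) : transpose (r • a) = r • transpose a :=
  (Lp.compMeasurePreservingₗ ℂ Prod.swap measurePreserving_swap).map_smul r a

theorem transpose_comp (a b : L2) : transpose (comp a b) = comp (transpose b) (transpose a) := by
  apply Lp.ext
  filter_upwards [coeFn_transpose (comp a b), ae_swap (coeFn_comp a b),
    comp_ae_eq (coeFn_transpose b) (coeFn_transpose a)] with q h₁ h₂ h₃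
  rw [h₁, h₃, h₂]
  exact integral_congr_ae (.of_forall fun z => mul_comm _ _)

theorem star_smul_L2 (r : ℂ) (a : L2) : star (r • a) = star r • star a := by
  apply Lp.ext
  filter_upwards [Lp.coeFn_star (r • a), Lp.coeFn_smul r a, Lp.coeFn_star a,
    Lp.coeFn_smul (star r) (star a)] with q h₁ h₂ h₃ h₄
  rw [h₁, h₄, Pi.star_apply, h₂, Pi.smul_apply, Pi.smul_apply, h₃, Pi.star_apply, star_smul]

theorem star_comp (a b : L2) : star (comp a b) = comp (star a) (star b) := by
  apply Lp.ext
  filter_upwards [Lp.coeFn_star (comp a b), coeFn_comp a b,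
    comp_ae_eq (Lp.coeFn_star a) (Lp.coeFn_star b)] with q h₁ h₂ h₃
  rw [h₁, h₃, Pi.star_apply, h₂, compFun, Complex.star_def, ← integral_conj]
  simp only [compFun, Pi.star_apply, map_mul, RCLike.star_def]

/-- The adjoint kernel `a*(x, y) = conj a(y, x)`. -/
def adj (a : L2) : L2 := star (transpose a)

theorem coeFn_adj (a : L2) : adj a =ᵐ[volume] fun q => star (a q.swap) := by
  filter_upwards [Lp.coeFn_star (transpose a), coeFn_transpose a] with q h₁ h₂
  rw [adj, h₁, Pi.star_apply, h₂]

theorem transpose_star (a : L2) : transpose (star a) = adj a := by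
  apply Lp.ext
  filter_upwards [coeFn_transpose (star a), ae_swap (Lp.coeFn_star a), coeFn_adj a] with q h₁ h₂ h₃
  rw [h₁, h₂, Pi.star_apply, h₃]

theorem adj_adj (a : L2) : adj (adj a) = a := by
  rw [← transpose_star, adj, star_star, transpose_transpose]

theorem norm_adj (a : L2) : ‖adj a‖ = ‖a‖ := by rw [adj, norm_star_L2, norm_transpose]

theorem adj_comp (a b : L2) : adj (comp a b) = comp (adj b) (adj a) := by
  rw [adj, transpose_comp, star_comp, adj, adj]

theorem adj_add (a b : L2) : adj (a + b) = adj a + adj b := by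
  apply Lp.ext
  filter_upwards [coeFn_adj (a + b), coeFn_adj a, coeFn_adj b, Lp.coeFn_add (adj a) (adj b),
    ae_swap (Lp.coeFn_add a b)] with q h₁ h₂ h₃ h₄ h₅
  rw [h₁, h₄, Pi.add_apply, h₂, h₃, h₅, Pi.add_apply, star_add]

theorem adj_smul (r : ℂ) (a : L2) : adj (r • a) = star r • adj a := by
  rw [adj, transpose_smul, star_smul_L2, adj]

theorem real_smul_L2 (r : ℝ) (a : L2) : r • a = (r : ℂ) • a := (algebraMap_smul ℂ r a).symm

/-- The adjoint as a real-linear isometry of `L²(ℝ³ × ℝ³)`. -/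
def adjₗᵢ : L2 →ₗᵢ[ℝ] L2 where
  toFun := adj
  map_add' := adj_add
  map_smul' r a := by
    rw [real_smul_L2, adj_smul, RingHom.id_apply, real_smul_L2, Complex.star_def,
      Complex.conj_ofReal]
  norm_map' := norm_adj

theorem adj_sub (a b : L2) : adj (a - b) = adj a - adj b := adjₗᵢ.map_sub a b

theorem continuous_adj : Continuous adj := adjₗᵢ.continuous

theorem comp_eq_adj_comp (a b : L2) : comp a b = adj (comp (adj b) (adj a)) := by
  rw [adj_comp, adj_adj, adj_adj]

theorem comp_add_left (a b c : L2) : comp (a + b) c = comp a c + comp b c := by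
  rw [comp_eq_adj_comp, adj_add, comp_add_right, adj_add, ← comp_eq_adj_comp, ← comp_eq_adj_comp]

theorem comp_smul_left (r : ℂ) (a b : L2) : comp (r • a) b = r • comp a b := by
  rw [comp_eq_adj_comp, adj_smul, comp_smul_right, adj_smul, ← comp_eq_adj_comp, star_star]

/-- Composition of kernels as a bounded bilinear map. -/
def compL : L2 →L[ℂ] L2 →L[ℂ] L2 :=
  (LinearMap.mk₂ ℂ comp comp_add_left comp_smul_left comp_add_right comp_smul_right).mkContinuous₂ 1
    fun a b => by rw [one_mul]; exact norm_comp_le a b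

theorem compL_apply (a b : L2) : compL a b = comp a b := rfl

theorem compLeft_add (a b : L2) : compLeft (a + b) = compLeft a + compLeft b := compL.map_add a b

/-- The kernel `|a(x, y)|`, which dominates the integrands of iterated compositions. -/
def absKer (a : L2) : L2 :=
  (show MemLp (fun q => ((‖a q‖ : ℝ) : ℂ)) 2 volume from (Lp.memLp a).norm.ofReal).toLp

theorem coeFn_absKer (a : L2) : absKer a =ᵐ[volume] fun q => ((‖a q‖ : ℝ) : ℂ) :=
  MemLp.coeFn_toLp _

theorem norm_coeFn_comp_absKer (a b : L2) :
    ∀ᵐ q : E × E, ‖comp (absKer a) (absKer b) q‖ = ∫ z, ‖a (q.1, z)‖ * ‖b (z, q.2)‖ := by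
  filter_upwards [comp_ae_eq (coeFn_absKer a) (coeFn_absKer b)] with q hq
  simp only [hq, compFun, ← Complex.ofReal_mul]
  rw [integral_complex_ofReal, Complex.norm_real,
    Real.norm_of_nonneg (integral_nonneg fun z => by positivity)]

theorem ae_integrable_comp_comp (a b c : L2) :
    ∀ᵐ q : E × E, Integrable fun s : E × E => a (q.1, s.1) * b s * c (s.2, q.2) := by
  have ha := (Lp.stronglyMeasurable a).measurable
  have hb := (Lp.stronglyMeasurable b).measurable
  have hc := (Lp.stronglyMeasurable c).measurable
  filter_upwards [ae_integrable_comp (absKer a) (comp (absKer b) (absKer c)),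
    ae_slice_left (coeFn_absKer a), ae_slice_right (norm_coeFn_comp_absKer b c),
    ae_slice_right (ae_integrable_comp b c)] with q h_int h_a h_bc h_slice
  refine (integrable_prod_iff (Measurable.aestronglyMeasurable (by fun_prop))).2 ⟨?_, ?_⟩
  · filter_upwards [h_slice] with w hw
    simpa only [mul_assoc] using hw.const_mul (a (q.1, w))
  · refine h_int.norm.congr ?_
    filter_upwards [h_a, h_bc] with w hw₁ hw₂
    rw [norm_mul, hw₁, hw₂, Complex.norm_real, norm_norm, ← integral_const_mul]
    simp only [norm_mul, mul_assoc]

theorem comp_assoc (a b c : L2) : comp (comp a b) c = comp a (comp b c) := by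
  apply Lp.ext
  filter_upwards [comp_ae_eq (coeFn_comp a b) (ae_eq_refl c),
    comp_ae_eq (ae_eq_refl a) (coeFn_comp b c),
    ae_integrable_comp_comp a b c] with q h_left h_right h_int
  rw [h_left, h_right]
  simp only [compFun]
  simp_rw [← integral_mul_const, ← integral_const_mul, ← mul_assoc]
  exact integral_integral_swap h_int.swap

theorem compLeft_comp (a b : L2) : compLeft (comp a b) = compLeft a * compLeft b :=
  ContinuousLinearMap.ext fun c => comp_assoc a b c

theorem inner_L2 (a b : L2) : inner ℂ a b = ∫ q, b q * star (a q) := by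
  rw [L2.inner_def]; simp only [RCLike.inner_apply, RCLike.star_def]

theorem integrable_mul_star (a b : L2) : Integrable fun q => b q * star (a q) := by
  simpa only [RCLike.inner_apply, RCLike.star_def] using L2.integrable_inner (𝕜 := ℂ) a b

theorem integrable_mul_star_comp (a b c : L2) : Integrable fun s : (E × E) × E =>
    c s.1 * star (a (s.1.1, s.2) * b (s.2, s.1.2)) := by
  have ha := (Lp.stronglyMeasurable a).measurable
  have hb := (Lp.stronglyMeasurable b).measurable
  have hc := (Lp.stronglyMeasurable c).measurable
  refine (integrable_prod_iff (Measurable.aestronglyMeasurable (by fun_prop))).2 ⟨?_, ?_⟩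
  · filter_upwards [ae_integrable_comp a b] with q hq
    exact (Complex.conjCLE.toContinuousLinearMap.integrable_comp hq).const_mul (c q)
  · refine (integrable_mul_star (comp (absKer a) (absKer b)) c).norm.congr ?_
    filter_upwards [norm_coeFn_comp_absKer a b] with q hq
    rw [norm_mul, norm_star, hq, ← integral_const_mul]
    simp only [norm_mul, norm_star]

theorem inner_comp_left (a b c : L2) : inner ℂ (comp a b) c = inner ℂ b (comp (adj a) c) := by
  calc inner ℂ (comp a b) c
      = ∫ q : E × E, ∫ z, c q * star (a (q.1, z) * b (z, q.2)) := by
        rw [inner_L2]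
        refine integral_congr_ae ?_
        filter_upwards [coeFn_comp a b] with q hq
        rw [hq, compFun, integral_const_mul, Complex.star_def, ← integral_conj]
    _ = ∫ q : E × E, ∫ x, c (x, q.2) * star (a (x, q.1) * b q) :=
        integral_integral_swapOuter (integrable_mul_star_comp a b c)
    _ = inner ℂ b (comp (adj a) c) := by
        rw [inner_L2]
        refine integral_congr_ae ?_
        filter_upwards [comp_ae_eq (coeFn_adj a) (ae_eq_refl c)] with q hq
        rw [hq, compFun, ← integral_mul_const]
        refine integral_congr_ae (.of_forall fun x => ?_)
        simp only [Prod.swap_prod_mk, star_mul']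
        ring

theorem inner_adj_adj (a b : L2) : inner ℂ (adj a) (adj b) = inner ℂ b a := by
  rw [inner_L2, inner_L2, ← measurePreserving_swap.integral_comp
    MeasurableEquiv.prodComm.measurableEmbedding (fun q => a q * star (b q))]
  refine integral_congr_ae ?_
  filter_upwards [coeFn_adj a, coeFn_adj b] with q h₁ h₂
  rw [h₁, h₂, star_star, mul_comm]

theorem inner_comp_right (a b c : L2) : inner ℂ (comp a b) c = inner ℂ a (comp c (adj b)) := by
  rw [← inner_adj_adj c, adj_comp, ← inner_adj_adj (comp c (adj b)), adj_comp, adj_adj,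
    ← inner_conj_symm, inner_comp_left, inner_conj_symm, adj_adj]

theorem adjoint_compLeft (a : L2) :
    ContinuousLinearMap.adjoint (compLeft a) = compLeft (adj a) := by
  refine ((ContinuousLinearMap.eq_adjoint_iff _ _).2 fun x y => ?_).symm
  rw [compLeft_apply, compLeft_apply, inner_comp_left, adj_adj]

/-! ### Hyperbolic functions of a symmetric kernel -/

section Series

theorem sum_range_two_mul_add_one {M : Type*} [AddCommMonoid M] (f : ℕ → M) (n : ℕ) :
    ∑ m ∈ Finset.range (2 * n + 1), f m
      = ∑ i ∈ Finset.range (n + 1), f (2 * i) + ∑ i ∈ Finset.range n, f (2 * i + 1) := by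
  induction n with
  | zero => simp
  | succ n ih =>
    rw [show 2 * (n + 1) + 1 = 2 * n + 1 + 1 + 1 by ring, Finset.sum_range_succ,
      Finset.sum_range_succ, ih, Finset.sum_range_succ _ (n + 1),
      Finset.sum_range_succ (fun i => f (2 * i + 1)) n, show 2 * (n + 1) = 2 * n + 1 + 1 by ring]
    abel

theorem sum_neg_one_pow_mul_inv_factorial {𝕜 : Type*} [Field 𝕜] [CharZero 𝕜] {n : ℕ}
    (hn : n ≠ 0) : ∑ m ∈ Finset.range (n + 1),
      (-1 : 𝕜) ^ m * ((m.factorial : 𝕜)⁻¹ * ((n - m).factorial : 𝕜)⁻¹) = 0 := by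
  have h_choose : ∑ m ∈ Finset.range (n + 1), (-1 : 𝕜) ^ m * (n.choose m : 𝕜) = 0 := by
    exact_mod_cast Int.alternating_sum_range_choose_of_ne hn
  rw [← mul_zero (n.factorial : 𝕜)⁻¹, ← h_choose, Finset.mul_sum]
  refine Finset.sum_congr rfl fun m hm => ?_
  have := Nat.cast_ne_zero (R := 𝕜).2 n.factorial_ne_zero
  rw [Nat.cast_choose 𝕜 (Nat.lt_succ_iff.1 (Finset.mem_range.1 hm))]
  field_simp

/-- The coefficients of `cosh² - 1 = sinh²`. -/
theorem sum_antidiagonal_inv_factorial_even_eq_odd {𝕜 : Type*} [Field 𝕜] [CharZero 𝕜] (n : ℕ) :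
    ∑ x ∈ antidiagonal (n + 1), ((2 * x.1).factorial : 𝕜)⁻¹ * ((2 * x.2).factorial : 𝕜)⁻¹
      = ∑ x ∈ antidiagonal n,
        ((2 * x.1 + 1).factorial : 𝕜)⁻¹ * ((2 * x.2 + 1).factorial : 𝕜)⁻¹ := by
  have h_alt := sum_neg_one_pow_mul_inv_factorial (𝕜 := 𝕜) (n := 2 * (n + 1)) (by omega)
  rw [sum_range_two_mul_add_one] at h_alt
  rw [Finset.Nat.sum_antidiagonal_eq_sum_range_succ
      (fun i j => ((2 * i).factorial : 𝕜)⁻¹ * ((2 * j).factorial : 𝕜)⁻¹),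
    Finset.Nat.sum_antidiagonal_eq_sum_range_succ
      (fun i j => ((2 * i + 1).factorial : 𝕜)⁻¹ * ((2 * j + 1).factorial : 𝕜)⁻¹),
    ← sub_eq_zero, sub_eq_add_neg, ← Finset.sum_neg_distrib, ← h_alt]
  congr 1 <;> refine Finset.sum_congr rfl fun i hi => ?_ <;> rw [Finset.mem_range] at hi
  · rw [pow_mul, neg_one_sq, one_pow, one_mul, show 2 * (n + 1) - 2 * i = 2 * (n + 1 - i) by omega]
  · rw [pow_succ, pow_mul, neg_one_sq, one_pow, one_mul, neg_one_mul,
      show 2 * (n + 1) - (2 * i + 1) = 2 * (n - i) + 1 by omega]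

theorem summable_norm_inv_factorial_smul {F : Type*} [NormedAddCommGroup F] [NormedSpace ℂ F]
    {a : ℕ → F} {r : ℝ} {d : ℕ → ℕ} (hd : d.Injective) (ha : ∀ n, ‖a n‖ ≤ r ^ d n) :
    Summable fun n => ‖((d n).factorial : ℂ)⁻¹ • a n‖ := by
  refine .of_nonneg_of_le (fun _ => norm_nonneg _) (fun n => ?_)
    ((Real.summable_pow_div_factorial r).comp_injective hd)
  rw [norm_smul, norm_inv, Complex.norm_natCast, Function.comp_apply, div_eq_inv_mul]
  gcongr
  exact ha n

theorem hasSum_sum_antidiagonal_bilinear {𝕜 F₁ F₂ F : Type*} [NontriviallyNormedField 𝕜]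
    [NormedAddCommGroup F₁] [NormedSpace 𝕜 F₁] [CompleteSpace F₁]
    [NormedAddCommGroup F₂] [NormedSpace 𝕜 F₂] [CompleteSpace F₂]
    [NormedAddCommGroup F] [NormedSpace 𝕜 F] [CompleteSpace F] (B : F₁ →L[𝕜] F₂ →L[𝕜] F)
    {f : ℕ → F₁} {g : ℕ → F₂} (hf : Summable fun n => ‖f n‖) (hg : Summable fun n => ‖g n‖) :
    HasSum (fun n => ∑ x ∈ antidiagonal n, B (f x.1) (g x.2))
      (B (∑' n, f n) (∑' n, g n)) := by
  have h_sum : Summable fun x : ℕ × ℕ => B (f x.1) (g x.2) := by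
    refine .of_norm_bounded ((hf.mul_of_nonneg hg (fun _ => norm_nonneg _)
      (fun _ => norm_nonneg _)).mul_left ‖B‖) fun x => ?_
    rw [← mul_assoc]
    exact B.le_opNorm₂ _ _
  have h_total : ∑' x : ℕ × ℕ, B (f x.1) (g x.2) = B (∑' n, f n) (∑' n, g n) := by
    rw [h_sum.tsum_prod, ← B.flip_apply, (B.flip _).map_tsum hf.of_norm]
    exact tsum_congr fun i => ((B (f i)).map_tsum hg.of_norm).symm
  have h_diag := (Finset.HasAntidiagonal.sigmaAntidiagonalEquivProd.hasSum_iff).2 h_sum.hasSum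
  rw [h_total] at h_diag
  convert! h_diag.sigma fun n => hasSum_fintype _ using 2 with n
  exact (Finset.sum_coe_sort (antidiagonal n) fun x => B (f x.1) (g x.2)).symm

end Series

section PowerTerms

theorem comp_shTerm_right (k : L2) (n : ℕ) :
    comp (shTerm k n) (comp (star k) k) = comp (comp k (star k)) (shTerm k n) := by
  induction n with
  | zero => simp only [shTerm, comp_assoc]
  | succ n ih => rw [shTerm, comp_assoc, ih]

theorem comp_chTerm_chTerm (k : L2) (i j : ℕ) :
    comp (chTerm k i) (chTerm k j) = chTerm k (i + j + 1) := by
  induction i with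
  | zero => rw [zero_add, chTerm, chTerm]
  | succ i ih => rw [chTerm.eq_2, comp_assoc, ih, Nat.add_right_comm i 1 j]; rfl

theorem comp_shTerm_star_shTerm (k : L2) (i j : ℕ) :
    comp (shTerm k i) (star (shTerm k j)) = chTerm k (i + j) := by
  induction j generalizing i with
  | zero =>
    induction i with
    | zero => rfl
    | succ i ih => rw [shTerm.eq_2, comp_assoc, ih]; rfl
  | succ j ih =>
    rw [shTerm, star_comp, star_comp, star_star, ← comp_assoc, comp_shTerm_right,
      ← shTerm, ih (i + 1), Nat.add_right_comm i 1 j, Nat.add_assoc]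

variable {k : L2}

theorem adj_eq_star_of_transpose_eq (hk : transpose k = k) : adj k = star k := by rw [adj, hk]

theorem transpose_shTerm (hk : transpose k = k) (n : ℕ) : transpose (shTerm k n) = shTerm k n := by
  induction n with
  | zero => exact hk
  | succ n ih =>
    rw [shTerm, transpose_comp, ih, transpose_comp, transpose_star, adj_eq_star_of_transpose_eq hk,
      hk, comp_shTerm_right]

theorem comp_shTerm_adj_shTerm (hk : transpose k = k) (i j : ℕ) :
    comp (shTerm k i) (adj (shTerm k j)) = chTerm k (i + j) := by
  rw [adj_eq_star_of_transpose_eq (transpose_shTerm hk j), comp_shTerm_star_shTerm]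

theorem adj_chTerm (hk : transpose k = k) (n : ℕ) : adj (chTerm k n) = chTerm k n := by
  rw [← Nat.zero_add n, ← comp_shTerm_adj_shTerm hk, adj_comp, adj_adj, comp_shTerm_adj_shTerm hk,
    comp_shTerm_adj_shTerm hk, Nat.add_comm]

end PowerTerms

theorem compLeft_adj (a : L2) : compLeft (adj a) = star (compLeft a) := (adjoint_compLeft a).symm

theorem isSelfAdjoint_compLeft {a : L2} (ha : adj a = a) : IsSelfAdjoint (compLeft a) := by
  rw [IsSelfAdjoint, ← compLeft_adj, ha]

theorem summable_norm_sh (k : L2) :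
    Summable fun n : ℕ => ‖(((2 * n + 1).factorial : ℂ)⁻¹) • shTerm k n‖ :=
  summable_norm_inv_factorial_smul (fun i j h => by simpa using h) (norm_shTerm_le k)

theorem summable_norm_ch (k : L2) :
    Summable fun n : ℕ => ‖(((2 * n + 2).factorial : ℂ)⁻¹) • chTerm k n‖ :=
  summable_norm_inv_factorial_smul (fun i j h => by simpa using h) (norm_chTerm_le k)

theorem hasSum_comp_chSubOne_self (k : L2) :
    HasSum (fun n => (∑ x ∈ antidiagonal n,
        ((2 * x.1 + 2).factorial : ℂ)⁻¹ * ((2 * x.2 + 2).factorial : ℂ)⁻¹) • chTerm k (n + 1))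
      (comp (chSubOne k) (chSubOne k)) := by
  convert! hasSum_sum_antidiagonal_bilinear compL (summable_norm_ch k) (summable_norm_ch k)
    using 2 with n
  rw [Finset.sum_smul]
  refine Finset.sum_congr rfl fun x hx => ?_
  rw [compL_apply, comp_smul_left, comp_smul_right, smul_smul, comp_chTerm_chTerm,
    mem_antidiagonal.1 hx]

theorem hasSum_two_smul_chSubOne_add_comp_self (k : L2) :
    HasSum (fun n => (∑ x ∈ antidiagonal (n + 1),
        ((2 * x.1).factorial : ℂ)⁻¹ * ((2 * x.2).factorial : ℂ)⁻¹) • chTerm k n)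
      ((2 : ℂ) • chSubOne k + comp (chSubOne k) (chSubOne k)) := by
  have h_two := (hasSum_nat_add_iff' 1).2 ((summable_ch k).hasSum.const_smul (2 : ℂ))
  refine (hasSum_nat_add_iff' 1).1 ?_
  convert! h_two.add (hasSum_comp_chSubOne_self k) using 1
  · ext1 n
    rw [Finset.Nat.antidiagonal_succ, Finset.sum_cons, Finset.sum_map,
      Finset.Nat.antidiagonal_succ', Finset.sum_cons, Finset.sum_map, smul_smul, ← add_smul]
    congr 1
    simp [mul_add]
    ring
  · rw [chSubOne, sub_add_eq_add_sub]
    simp [Finset.Nat.antidiagonal_succ, ← two_mul, smul_smul]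

section Symmetric

variable {k : L2}

theorem hasSum_comp_sh_adj_sh (hk : transpose k = k) :
    HasSum (fun n => (∑ x ∈ antidiagonal n,
        ((2 * x.1 + 1).factorial : ℂ)⁻¹ * ((2 * x.2 + 1).factorial : ℂ)⁻¹) • chTerm k n)
      (comp (sh k) (adj (sh k))) := by
  have h_adj : adj (sh k) = ∑' n, adj (((2 * n + 1).factorial : ℂ)⁻¹ • shTerm k n) :=
    adjₗᵢ.toContinuousLinearMap.map_tsum (summable_sh k)
  rw [h_adj]
  convert! hasSum_sum_antidiagonal_bilinear compL (summable_norm_sh k)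
    (g := fun n => adj (((2 * n + 1).factorial : ℂ)⁻¹ • shTerm k n))
    (by simpa only [norm_adj] using summable_norm_sh k) using 2 with n
  rw [Finset.sum_smul]
  refine Finset.sum_congr rfl fun x hx => ?_
  rw [compL_apply, adj_smul, comp_smul_left, comp_smul_right, smul_smul, comp_shTerm_adj_shTerm hk,
    mem_antidiagonal.1 hx, star_inv₀, star_natCast]

theorem two_smul_chSubOne_add_comp_self (hk : transpose k = k) :
    (2 : ℂ) • chSubOne k + comp (chSubOne k) (chSubOne k) = comp (sh k) (adj (sh k)) := by
  refine (hasSum_two_smul_chSubOne_add_comp_self k).unique ?_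
  simpa only [sum_antidiagonal_inv_factorial_even_eq_odd] using hasSum_comp_sh_adj_sh hk

theorem adj_chSubOne (hk : transpose k = k) : adj (chSubOne k) = chSubOne k := by
  refine (adjₗᵢ.toContinuousLinearMap.map_tsum (summable_ch k)).trans (tsum_congr fun n => ?_)
  exact (adj_smul _ _).trans (by rw [adj_chTerm hk, star_inv₀, star_natCast])

theorem compLeft_chTerm_nonneg (hk : transpose k = k) (n : ℕ) : 0 ≤ compLeft (chTerm k n) := by
  obtain ⟨i, rfl | rfl⟩ := n.even_or_odd'
  · rw [two_mul, ← comp_shTerm_adj_shTerm hk, compLeft_comp, compLeft_adj]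
    exact mul_star_self_nonneg _
  · rw [two_mul, ← comp_chTerm_chTerm, compLeft_comp]
    exact (isSelfAdjoint_compLeft (adj_chTerm hk i)).mul_self_nonneg

open scoped ComplexOrder in
theorem compLeft_chSubOne_nonneg (hk : transpose k = k) : 0 ≤ compLeft (chSubOne k) := by
  have h_sum : HasSum (fun n => compLeft (((2 * n + 2).factorial : ℂ)⁻¹ • chTerm k n))
      (compLeft (chSubOne k)) := compL.hasSum (summable_ch k).hasSum
  refine h_sum.nonneg fun n => ?_
  have h_pos := (ContinuousLinearMap.nonneg_iff_isPositive _).1 (compLeft_chTerm_nonneg hk n)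
  have h_smul := h_pos.smul_of_nonneg (c := ((2 * n + 2).factorial : ℂ)⁻¹)
    (inv_nonneg.2 (Nat.cast_nonneg _))
  rw [ContinuousLinearMap.nonneg_iff_isPositive]
  convert h_smul using 1
  exact compL.map_smul _ _

theorem isUnit_one_add_compLeft_chSubOne (hk : transpose k = k) :
    IsUnit (1 + compLeft (chSubOne k)) :=
  CStarAlgebra.isUnit_of_le 1 (le_add_of_nonneg_right (compLeft_chSubOne_nonneg hk))

end Symmetric

/-! ### Calculus of absolutely continuous functions -/

section AbsolutelyContinuous

variable {X : Type*} [NormedAddCommGroup X] [NormedSpace ℝ X]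

theorem absolutelyContinuousOnInterval_of_dist_le {M : Type*} [PseudoMetricSpace M] {f : ℝ → M}
    {g : ℝ → ℝ} {a b : ℝ} (hg : AbsolutelyContinuousOnInterval g a b)
    (h : ∀ s ∈ uIcc a b, ∀ r ∈ uIcc a b, dist (f s) (f r) ≤ dist (g s) (g r)) :
    AbsolutelyContinuousOnInterval f a b := by
  refine squeeze_zero' (Eventually.of_forall fun _ => Finset.sum_nonneg fun _ _ => dist_nonneg)
    ?_ hg
  filter_upwards [mem_inf_of_right (mem_principal_self _)] with I hI
  exact Finset.sum_le_sum fun i hi => h _ (hI.1 i hi).1 _ (hI.1 i hi).2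

theorem dist_integral_le_dist_integral {f : ℝ → X} {g : ℝ → ℝ} {a b : ℝ}
    (hf : IntervalIntegrable f volume a b) (hg : IntervalIntegrable g volume a b)
    (hfg : ∀ s, ‖f s‖ ≤ g s) {s r : ℝ} (hs : s ∈ uIcc a b) (hr : r ∈ uIcc a b) :
    dist (∫ τ in a..s, f τ) (∫ τ in a..r, f τ) ≤ dist (∫ τ in a..s, g τ) (∫ τ in a..r, g τ) := by
  have hmono : ∀ {c}, c ∈ uIcc a b → uIcc a c ⊆ uIcc a b := fun hc =>
    uIcc_subset_uIcc left_mem_uIcc hc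
  rw [dist_eq_norm, dist_eq_norm,
    intervalIntegral.integral_interval_sub_left (hf.mono_set (hmono hs)) (hf.mono_set (hmono hr)),
    intervalIntegral.integral_interval_sub_left (hg.mono_set (hmono hs)) (hg.mono_set (hmono hr))]
  exact intervalIntegral.norm_integral_le_abs_of_norm_le (Eventually.of_forall hfg)
    (hg.mono_set (uIcc_subset_uIcc hr hs))

/-- Absolute continuity is expressed by a majorant of the increments. -/
theorem integral_eq_sub_of_ae_hasDerivAt_of_dist_le [CompleteSpace X] {f f' : ℝ → X} {g : ℝ → ℝ}
    {a b C : ℝ} (hf' : IntervalIntegrable f' volume a b) (hg : IntervalIntegrable g volume a b)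
    (hfg : ∀ s ∈ uIcc a b, ∀ r ∈ uIcc a b,
      dist (f s) (f r) ≤ C * dist (∫ τ in a..s, g τ) (∫ τ in a..r, g τ))
    (hderiv : ∀ᵐ s, s ∈ uIcc a b → HasDerivAt f (f' s) s) :
    ∫ s in a..b, f' s = f b - f a := by
  have hac : AbsolutelyContinuousOnInterval (fun s => f s - ∫ τ in a..s, f' τ) a b :=
    (absolutelyContinuousOnInterval_of_dist_le
      ((hg.absolutelyContinuousOnInterval_intervalIntegral left_mem_uIcc).const_mul C)
      fun s hs r hr => (hfg s hs r hr).trans <| by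
        rw [Real.dist_eq, Real.dist_eq, ← mul_sub, abs_mul]
        gcongr
        exact le_abs_self C).sub
    (absolutelyContinuousOnInterval_of_dist_le
      (hf'.norm.absolutelyContinuousOnInterval_intervalIntegral left_mem_uIcc) fun _ hs _ hr =>
        dist_integral_le_dist_integral hf' hf'.norm (fun _ => le_rfl) hs hr)
  have hzero : ∀ᵐ s, s ∈ uIcc a b → HasDerivAt (fun s => f s - ∫ τ in a..s, f' τ) 0 s := by
    filter_upwards [hderiv, hf'.ae_hasDerivAt_integral] with s h₁ h₂ hs
    simpa only [sub_self] using (h₁ hs).fun_sub (h₂ hs a left_mem_uIcc)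
  obtain ⟨c, hc⟩ := hac.const_of_ae_hasDerivAt_zero hzero
  have ha := hc a left_mem_uIcc
  have hb := hc b right_mem_uIcc
  rw [intervalIntegral.integral_same, sub_zero] at ha
  rw [ha, ← hb, sub_sub_cancel]

section Bilinear

variable {Y Z : Type*} [NormedAddCommGroup Y] [NormedSpace ℝ Y] [NormedAddCommGroup Z]
  [NormedSpace ℝ Z] (L : X →L[ℝ] Y →L[ℝ] Z)

theorem norm_bilinear_sub_bilinear_le (x₁ x₂ : X) (y₁ y₂ : Y) :
    ‖L x₁ y₁ - L x₂ y₂‖ ≤ ‖L‖ * (‖x₁ - x₂‖ * ‖y₁‖ + ‖x₂‖ * ‖y₁ - y₂‖) := by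
  have hsplit : L x₁ y₁ - L x₂ y₂ = L (x₁ - x₂) y₁ + L x₂ (y₁ - y₂) := by
    simp only [map_sub, sub_apply, sub_add_sub_cancel]
  rw [hsplit, mul_add, ← mul_assoc, ← mul_assoc]
  exact norm_add_le_of_le (L.le_opNorm₂ _ _) (L.le_opNorm₂ _ _)

theorem exists_norm_bilinear_sub_bilinear_le {x : ℝ → X} {y : ℝ → Y} {s : Set ℝ}
    (hs : IsCompact s) (hx : ContinuousOn x s) (hy : ContinuousOn y s) :
    ∃ C, ∀ r ∈ s, ∀ t ∈ s,
      ‖L (x r) (y r) - L (x t) (y t)‖ ≤ C * (‖x r - x t‖ + ‖y r - y t‖) := by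
  obtain ⟨M, hM⟩ := hs.exists_bound_of_continuousOn hx
  obtain ⟨N, hN⟩ := hs.exists_bound_of_continuousOn hy
  refine ⟨‖L‖ * (N + M), fun r hr t ht => (norm_bilinear_sub_bilinear_le L _ _ _ _).trans ?_⟩
  have hM' := hM t ht
  have hN' := hN r hr
  have : ‖x r - x t‖ * ‖y r‖ + ‖x t‖ * ‖y r - y t‖
      ≤ (N + M) * (‖x r - x t‖ + ‖y r - y t‖) := by
    nlinarith [norm_nonneg (x r - x t), norm_nonneg (y r - y t), norm_nonneg (y r),
      norm_nonneg (x t)]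
  rw [mul_assoc]
  gcongr

theorem integrableOn_bilinear_continuousOn {x : ℝ → X} {y : ℝ → Y} {s : Set ℝ} (hs : IsCompact s)
    (hx : IntegrableOn x s) (hy : ContinuousOn y s) : IntegrableOn (fun t => L (x t) (y t)) s := by
  obtain ⟨N, hN⟩ := hs.exists_bound_of_continuousOn hy
  refine Integrable.mono' (hx.norm.const_mul (‖L‖ * N)) (L.aestronglyMeasurable_comp₂
    hx.aestronglyMeasurable (hy.aestronglyMeasurable_of_isCompact hs hs.measurableSet)) ?_
  filter_upwards [ae_restrict_mem hs.measurableSet] with t ht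
  calc ‖L (x t) (y t)‖ ≤ ‖L‖ * ‖x t‖ * ‖y t‖ := L.le_opNorm₂ _ _
    _ ≤ ‖L‖ * ‖x t‖ * N := by gcongr; exact hN t ht
    _ = ‖L‖ * N * ‖x t‖ := by ring

theorem tendsto_integral_bilinear {Q : ℕ → Y → Y} (hQ : ∀ n, Continuous (Q n))
    (hQ_norm : ∀ n y, ‖Q n y‖ ≤ ‖y‖) (hQ_tendsto : ∀ y, Tendsto (fun n => Q n y) atTop (𝓝 y))
    {x : ℝ → X} {y : ℝ → Y} {a b : ℝ}
    (hx : AEStronglyMeasurable x (volume.restrict (uIoc a b)))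
    (hy : AEStronglyMeasurable y (volume.restrict (uIoc a b)))
    (hxy : IntervalIntegrable (fun s => ‖x s‖ * ‖y s‖) volume a b) :
    Tendsto (fun n => ∫ s in a..b, L (x s) (Q n (y s))) atTop (𝓝 (∫ s in a..b, L (x s) (y s))) := by
  refine intervalIntegral.tendsto_integral_filter_of_dominated_convergence
    (fun s => ‖L‖ * (‖x s‖ * ‖y s‖))
    (Eventually.of_forall fun n =>
      L.aestronglyMeasurable_comp₂ hx ((hQ n).comp_aestronglyMeasurable hy))
    (Eventually.of_forall fun n => Eventually.of_forall fun s _ => ?_) (hxy.const_mul _)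
    (Eventually.of_forall fun s _ => ((L (x s)).continuous.tendsto _).comp (hQ_tendsto (y s)))
  rw [← mul_assoc]
  exact (L.le_opNorm₂ _ _).trans (by gcongr; exact hQ_norm n _)

theorem integral_bilinear_deriv_add_eq_sub [CompleteSpace X] [CompleteSpace Y] [CompleteSpace Z]
    {x x' : ℝ → X} {y y' : ℝ → Y} {a b : ℝ}
    (hx' : IntervalIntegrable x' volume a b) (hy' : IntervalIntegrable y' volume a b)
    (hx : ∀ s ∈ uIcc a b, x s = x a + ∫ r in a..s, x' r)
    (hy : ∀ s ∈ uIcc a b, y s = y a + ∫ r in a..s, y' r) :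
    ∫ s in a..b, (L (x' s) (y s) + L (x s) (y' s)) = L (x b) (y b) - L (x a) (y a) := by
  let ξ : ℝ → X := fun s => x a + ∫ r in a..s, x' r
  let η : ℝ → Y := fun s => y a + ∫ r in a..s, y' r
  have hξ : ContinuousOn ξ (uIcc a b) := continuousOn_const.add
    (intervalIntegral.continuousOn_primitive_interval' hx' left_mem_uIcc)
  have hη : ContinuousOn η (uIcc a b) := continuousOn_const.add
    (intervalIntegral.continuousOn_primitive_interval' hy' left_mem_uIcc)
  have hderiv : ∀ᵐ s, s ∈ uIcc a b →
      HasDerivAt (fun s => L (ξ s) (η s)) (L (x' s) (η s) + L (ξ s) (y' s)) s := by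
    filter_upwards [hx'.ae_hasDerivAt_integral, hy'.ae_hasDerivAt_integral] with s h₁ h₂ hs
    rw [add_comm]
    exact L.hasDerivAt_of_bilinear (fun _ => (h₁ hs a left_mem_uIcc).const_add _)
      fun _ => (h₂ hs a left_mem_uIcc).const_add _
  have h_int : IntervalIntegrable (fun s => L (x' s) (η s) + L (ξ s) (y' s)) volume a b := by
    rw [intervalIntegrable_iff'] at hx' hy' ⊢
    exact (integrableOn_bilinear_continuousOn L isCompact_uIcc hx' hη).add
      (integrableOn_bilinear_continuousOn L.flip isCompact_uIcc hy' hξ)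
  obtain ⟨C, hC⟩ := exists_norm_bilinear_sub_bilinear_le L isCompact_uIcc hξ hη
  have hdist : ∀ s ∈ uIcc a b, ∀ r ∈ uIcc a b, dist (L (ξ s) (η s)) (L (ξ r) (η r))
      ≤ 2 * |C| * dist (∫ τ in a..s, (‖x' τ‖ + ‖y' τ‖)) (∫ τ in a..r, (‖x' τ‖ + ‖y' τ‖)) := by
    intro s hs r hr
    have h₁ := dist_integral_le_dist_integral hx' (hx'.norm.add hy'.norm)
      (fun τ => le_add_of_nonneg_right (norm_nonneg (y' τ))) hs hr
    have h₂ := dist_integral_le_dist_integral hy' (hx'.norm.add hy'.norm)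
      (fun τ => le_add_of_nonneg_left (norm_nonneg (x' τ))) hs hr
    rw [← dist_add_left (x a), dist_eq_norm] at h₁
    rw [← dist_add_left (y a), dist_eq_norm] at h₂
    rw [dist_eq_norm]
    calc ‖L (ξ s) (η s) - L (ξ r) (η r)‖
        ≤ C * (‖ξ s - ξ r‖ + ‖η s - η r‖) := hC s hs r hr
      _ ≤ |C| * (‖ξ s - ξ r‖ + ‖η s - η r‖) := by gcongr; exact le_abs_self C
      _ ≤ |C| * _ := by grw [h₁, h₂]
      _ = _ := by ring
  have h := integral_eq_sub_of_ae_hasDerivAt_of_dist_le h_int (hx'.norm.add hy'.norm) hdist hderiv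
  rw [hx b right_mem_uIcc, hy b right_mem_uIcc]
  simp only [ξ, η, intervalIntegral.integral_same, add_zero] at h
  rw [← h]
  exact intervalIntegral.integral_congr fun s hs => by
    rw [hx s hs, hy s hs]

end Bilinear

theorem intervalIntegrable_of_integrableOn_Icc {F : Type*} [NormedAddCommGroup F] {f : ℝ → F}
    {T t : ℝ} (h : IntegrableOn f (Icc 0 T)) (ht : t ∈ Icc 0 T) :
    IntervalIntegrable f volume 0 t := by
  rw [intervalIntegrable_iff_integrableOn_Icc_of_le ht.1]
  exact h.mono_set (Icc_subset_Icc_right ht.2)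

theorem ae_eq_of_integral_eq [CompleteSpace X] {f g : ℝ → X} {T : ℝ}
    (hf : IntegrableOn f (Icc 0 T)) (hg : IntegrableOn g (Icc 0 T))
    (h : ∀ t ∈ Icc 0 T, ∫ s in (0 : ℝ)..t, f s = ∫ s in (0 : ℝ)..t, g s) :
    f =ᵐ[volume.restrict (Icc 0 T)] g := by
  rcases lt_or_ge T 0 with hT | hT
  · rw [Icc_eq_empty (not_le.2 hT), Measure.restrict_empty, ae_zero]
    exact eventually_bot
  have hT' : T ∈ Icc 0 T := right_mem_Icc.2 hT
  rw [← restrict_Ioo_eq_restrict_Icc, EventuallyEq, ae_restrict_iff' measurableSet_Ioo]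
  filter_upwards [(intervalIntegrable_of_integrableOn_Icc hf hT').ae_hasDerivAt_integral,
    (intervalIntegrable_of_integrableOn_Icc hg hT').ae_hasDerivAt_integral] with s hfs hgs hs
  have hs' : s ∈ uIcc 0 T := by
    rw [uIcc_of_le hT]
    exact Ioo_subset_Icc_self hs
  refine (hfs hs' 0 left_mem_uIcc).unique
    ((hgs hs' 0 left_mem_uIcc).congr_of_eventuallyEq ?_)
  filter_upwards [Ioo_mem_nhds hs.1 hs.2] with r hr using h r (Ioo_subset_Icc_self hr)

end AbsolutelyContinuous

/-! ### Translation and mollification of kernels -/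

section Translate

instance : (volume : Measure (E × E)).IsAddHaarMeasure :=
  inferInstanceAs ((volume : Measure E).prod (volume : Measure E)).IsAddHaarMeasure

instance : (volume : Measure (E × E)).IsNegInvariant :=
  Measure.IsAddHaarMeasure.isNegInvariant_of_regular _

/-- The translate `q ↦ a (q - z)` of a kernel `a`. -/
def translate (z : E × E) : L2 →ₗᵢ[ℂ] L2 :=
  Lp.compMeasurePreservingₗᵢ ℂ (fun q => q - z)
    (measurePreserving_sub_right (volume : Measure (E × E)) z)

theorem coeFn_translate (z : E × E) (a : L2) : translate z a =ᵐ[volume] fun q => a (q - z) :=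
  Lp.coeFn_compMeasurePreserving _ _

theorem ae_sub {P : E × E → Prop} (h : ∀ᵐ q, P q) (z : E × E) : ∀ᵐ q, P (q - z) :=
  (measurePreserving_sub_right volume z).quasiMeasurePreserving.ae h

theorem continuous_translate (a : L2) : Continuous fun z => translate z a := by
  let shift : C((E × E) × (E × E), E × E) := ⟨fun p => p.2 - p.1, by fun_prop⟩
  exact Continuous.compMeasurePreservingLp (continuous_const (y := a)) shift.curry.continuous
    (fun z => measurePreserving_sub_right volume z) (by norm_num)

theorem translate_translate (z w : E × E) (a : L2) :
    translate z (translate w a) = translate (z + w) a := by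
  apply Lp.ext
  filter_upwards [coeFn_translate z (translate w a), ae_sub (coeFn_translate w a) z,
    coeFn_translate (z + w) a] with q h₁ h₂ h₃
  rw [h₁, h₂, h₃, sub_sub]

theorem translate_zero (a : L2) : translate 0 a = a := by
  apply Lp.ext
  filter_upwards [coeFn_translate 0 a] with q h
  rw [h, sub_zero]

theorem adj_translate (z : E × E) (a : L2) : adj (translate z a) = translate z.swap (adj a) := by
  apply Lp.ext
  filter_upwards [coeFn_adj (translate z a), ae_swap (coeFn_translate z a),
    coeFn_translate z.swap (adj a), ae_sub (coeFn_adj a) z.swap] with q h₁ h₂ h₃ h₄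
  rw [h₁, h₂, h₃, h₄]
  rfl

theorem inner_translate_left (z : E × E) (a b : L2) :
    inner ℂ (translate z a) b = inner ℂ a (translate (-z) b) := by
  rw [← (translate (-z)).inner_map_map, translate_translate, neg_add_cancel, translate_zero]

theorem comp_translate_left (z : E) (a b : L2) :
    comp (translate (z, 0) a) b = translate (z, 0) (comp a b) := by
  apply Lp.ext
  filter_upwards [comp_ae_eq (coeFn_translate (z, 0) a) (EventuallyEq.refl _ b),
    coeFn_translate (z, 0) (comp a b), ae_sub (coeFn_comp a b) (z, 0)] with q h₁ h₂ h₃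
  rw [h₁, h₂, h₃]
  simp only [compFun, Prod.mk_sub_mk, sub_zero, Prod.fst_sub, Prod.snd_sub]

theorem comp_translate_right (z : E) (a b : L2) :
    comp a (translate (0, z) b) = translate (0, z) (comp a b) := by
  rw [comp_eq_adj_comp, adj_translate, Prod.swap_prod_mk, comp_translate_left, ← adj_comp,
    adj_translate, adj_adj, Prod.swap_prod_mk]

theorem comp_translate_middle (z : E) (a b : L2) :
    comp (translate (0, z) a) b = comp a (translate (-z, 0) b) := by
  apply Lp.ext
  filter_upwards [comp_ae_eq (coeFn_translate (0, z) a) (EventuallyEq.refl _ b),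
    comp_ae_eq (EventuallyEq.refl _ a) (coeFn_translate (-z, 0) b)] with q h₁ h₂
  rw [h₁, h₂]
  simp only [compFun, Prod.mk_sub_mk, sub_zero, sub_neg_eq_add]
  rw [← integral_add_right_eq_self _ z]
  simp only [add_sub_cancel_right]

theorem inner_translate_right (χ a : L2) (z : E × E) :
    inner ℂ χ (translate z a) = ∫ q, a (q - z) * star (χ q) := by
  rw [inner_L2]
  refine integral_congr_ae ?_
  filter_upwards [coeFn_translate z a] with q hq
  rw [hq]

theorem integrable_translate_mul_star (a χ : L2) (z : E × E) :
    Integrable fun q => a (q - z) * star (χ q) := by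
  refine (integrable_mul_star χ (translate z a)).congr ?_
  filter_upwards [coeFn_translate z a] with q hq
  rw [hq]

theorem norm_absKer (a : L2) : ‖absKer a‖ = ‖a‖ := by
  rw [absKer, Lp.norm_toLp, Lp.norm_def]
  congr 1
  refine eLpNorm_congr_norm_ae (Eventually.of_forall fun q => ?_)
  simp only [Complex.norm_real, norm_norm]

theorem integral_norm_translate_mul_star_le (a χ : L2) (z : E × E) :
    ∫ q, ‖a (q - z) * star (χ q)‖ ≤ ‖a‖ * ‖χ‖ := by
  have hinner : ∫ q, ‖a (q - z) * star (χ q)‖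
      = (inner ℂ (absKer χ) (absKer (translate z a))).re := by
    rw [inner_L2, ← Complex.reCLM_apply, ← Complex.reCLM.integral_comp_comm
      (integrable_mul_star _ _)]
    refine integral_congr_ae ?_
    filter_upwards [coeFn_translate z a, coeFn_absKer χ, coeFn_absKer (translate z a)]
      with q h₁ h₂ h₃
    rw [h₂, h₃, h₁]
    simp
  rw [hinner, mul_comm]
  refine (Complex.re_le_norm _).trans ((norm_inner_le_norm _ _).trans_eq ?_)
  rw [norm_absKer, norm_absKer, LinearIsometry.norm_map]

theorem integrable_mul_translate_mul_star {F : E × E → ℝ} (hF : Integrable F) (hF' : Measurable F)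
    (a χ : L2) : Integrable (fun s : (E × E) × (E × E) =>
      (F s.1 : ℂ) * (a (s.2 - s.1) * star (χ s.2))) (volume.prod volume) := by
  have ha := (Lp.stronglyMeasurable a).measurable
  have hχ := (Lp.stronglyMeasurable χ).measurable
  have hmeas : Measurable fun s : (E × E) × (E × E) =>
      (F s.1 : ℂ) * (a (s.2 - s.1) * star (χ s.2)) := by fun_prop
  rw [integrable_prod_iff hmeas.aestronglyMeasurable]
  refine ⟨Eventually.of_forall fun z => (integrable_translate_mul_star a χ z).const_mul (F z : ℂ),
    Integrable.mono' (hF.norm.mul_const (‖a‖ * ‖χ‖))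
      hmeas.norm.stronglyMeasurable.integral_prod_right'.aestronglyMeasurable
      (Eventually.of_forall fun z => ?_)⟩
  rw [Real.norm_of_nonneg (integral_nonneg fun _ => norm_nonneg _)]
  simp only [norm_mul (F z : ℂ), Complex.norm_real, integral_const_mul]
  gcongr
  exact integral_norm_translate_mul_star_le a χ z

end Translate

section Laplacian

theorem laplacian_comp_neg {f : E → ℝ} (hf : ContDiff ℝ 2 f) (x : E) :
    Laplacian.laplacian (fun y => f (-y)) x = Laplacian.laplacian f (-x) := by
  simp only [InnerProductSpace.laplacian_eq_iteratedFDeriv_stdOrthonormalBasis]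
  refine Finset.sum_congr rfl fun i _ => ?_
  have hcomp := (-ContinuousLinearMap.id ℝ E).iteratedFDeriv_comp_right hf x (i := 2) le_rfl
  have hneg := (iteratedFDeriv ℝ 2 f (-x)).map_smul_univ (fun _ => (-1 : ℝ))
    ![stdOrthonormalBasis ℝ E i, stdOrthonormalBasis ℝ E i]
  rw [show (fun y => f (-y)) = f ∘ (-ContinuousLinearMap.id ℝ E) from rfl, hcomp]
  simp only [Finset.prod_const, Finset.card_univ, Fintype.card_fin, even_two, Even.neg_pow,
    one_pow, one_smul, neg_smul] at hneg
  exact hneg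

theorem laplacian_comp_sub (f : E → ℝ) (x₀ x : E) :
    Laplacian.laplacian (fun y => f (y - x₀)) x = Laplacian.laplacian f (x - x₀) := by
  simp only [InnerProductSpace.laplacian_eq_iteratedFDeriv_stdOrthonormalBasis,
    iteratedFDeriv_comp_sub]

theorem contDiff_laplacian {f : E → ℝ} (hf : ContDiff ℝ ∞ f) :
    ContDiff ℝ ∞ (Laplacian.laplacian f) := by
  rw [InnerProductSpace.laplacian_eq_iteratedFDeriv_stdOrthonormalBasis]
  refine ContDiff.sum fun i _ => ?_
  have h : ContDiff ℝ ∞ (iteratedFDeriv ℝ 2 f) := hf.iteratedFDeriv_right (by norm_cast)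
  exact (ContinuousMultilinearMap.apply ℝ (fun _ : Fin 2 => E) ℝ
    ![stdOrthonormalBasis ℝ E i, stdOrthonormalBasis ℝ E i]).contDiff.comp h

theorem hasCompactSupport_laplacian {f : E → ℝ} (hf : HasCompactSupport f) :
    HasCompactSupport (Laplacian.laplacian f) := by
  rw [InnerProductSpace.laplacian_eq_iteratedFDeriv_stdOrthonormalBasis]
  refine (hf.iteratedFDeriv (𝕜 := ℝ) 2).mono fun x hx => ?_
  contrapose! hx
  rw [Function.notMem_support] at hx ⊢
  simp only [hx, zero_apply, Finset.sum_const_zero]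

end Laplacian

/-- A smooth, compactly supported, even, real-valued function on `ℝ³`. Evenness makes mollification
by it self-adjoint. -/
structure EvenTestFunction where
  toFun : E → ℝ
  contDiff : ContDiff ℝ ∞ toFun
  hasCompactSupport : HasCompactSupport toFun
  even : ∀ x, toFun (-x) = toFun x

namespace EvenTestFunction

instance : CoeFun EvenTestFunction (fun _ => E → ℝ) := ⟨toFun⟩

@[fun_prop]
theorem continuous (f : EvenTestFunction) : Continuous f := f.contDiff.continuous

theorem integrable (f : EvenTestFunction) : Integrable f :=
  f.continuous.integrable_of_hasCompactSupport f.hasCompactSupport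

/-- The Laplacian of an even test function. -/
def lap (f : EvenTestFunction) : EvenTestFunction where
  toFun := Laplacian.laplacian f.toFun
  contDiff := contDiff_laplacian f.contDiff
  hasCompactSupport := hasCompactSupport_laplacian f.hasCompactSupport
  even x := by
    rw [← laplacian_comp_neg (f.contDiff.of_le ENat.LEInfty.out)]
    simp only [f.even]

theorem laplacian_const_mul_comp_sub (f : EvenTestFunction) (c : ℝ) (x₀ x : E) :
    Laplacian.laplacian (fun y : E => ((c * f (y - x₀) : ℝ) : ℂ)) x
      = ((c * f.lap (x - x₀) : ℝ) : ℂ) := by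
  let l : ℝ →L[ℝ] ℂ := c • Complex.ofRealCLM
  have hl : ∀ r : ℝ, l r = ((c * r : ℝ) : ℂ) := fun r => by simp [l]
  have hf : ContDiff ℝ 2 fun y => f (y - x₀) :=
    (f.contDiff.of_le ENat.LEInfty.out).comp (by fun_prop)
  have h := hf.contDiffAt.laplacian_CLM_comp_left (l := l) (x := x)
  rw [Function.comp_apply, laplacian_comp_sub] at h
  simp only [Function.comp_def, hl] at h
  exact h

end EvenTestFunction

section Average

variable (ι κ : E →L[ℝ] E × E) (f g : EvenTestFunction)

theorem integrable_smul_translate (a : L2) :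
    Integrable fun z => (f z : ℂ) • translate (ι z) a := by
  refine Continuous.integrable_of_hasCompactSupport
    ((Complex.continuous_ofReal.comp f.continuous).smul
      ((continuous_translate a).comp ι.continuous)) ?_
  refine f.hasCompactSupport.mono fun z hz => ?_
  contrapose! hz
  rw [Function.notMem_support] at hz ⊢
  rw [hz, Complex.ofReal_zero, zero_smul]

theorem integrable_mul_smul_translate (a : L2) :
    Integrable (fun z : E × E => ((f z.1 * g z.2 : ℝ) : ℂ) • translate (ι z.1 + κ z.2) a)
      (volume.prod volume) := by
  refine Integrable.mono' (f.integrable.norm.mul_prod (g.integrable.norm.mul_const ‖a‖))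
    (Continuous.aestronglyMeasurable (Continuous.fun_smul (by fun_prop)
      ((continuous_translate a).comp (by fun_prop)))) (Eventually.of_forall fun z => ?_)
  simp only [norm_smul, Complex.norm_real, LinearIsometry.norm_map, norm_mul, mul_assoc]
  exact le_rfl

theorem norm_integral_smul_translate_le (a : L2) :
    ‖∫ z, (f z : ℂ) • translate (ι z) a‖ ≤ (∫ z, |f z|) * ‖a‖ := by
  refine (norm_integral_le_integral_norm _).trans_eq ?_
  simp only [norm_smul, Complex.norm_real, Real.norm_eq_abs, LinearIsometry.norm_map,
    integral_mul_const]

/-- The average `∫ f(z) a(· - ι z) dz` of the translates of a kernel along `ι`. -/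
def average : L2 →L[ℂ] L2 :=
  LinearMap.mkContinuous
    { toFun := fun a => ∫ z, (f z : ℂ) • translate (ι z) a
      map_add' := fun a b => by
        rw [← integral_add (integrable_smul_translate ι f a) (integrable_smul_translate ι f b)]
        simp only [map_add, smul_add]
      map_smul' := fun r a => by
        rw [RingHom.id_apply, ← integral_smul]
        simp only [map_smul, smul_comm r] }
    (∫ z, |f z|) (norm_integral_smul_translate_le ι f)

theorem average_apply (a : L2) : average ι f a = ∫ z, (f z : ℂ) • translate (ι z) a := rfl

theorem norm_average_le (a : L2) : ‖average ι f a‖ ≤ (∫ z, |f z|) * ‖a‖ :=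
  norm_integral_smul_translate_le ι f a

theorem map_average {F : Type*} [NormedAddCommGroup F] [NormedSpace ℂ F] [CompleteSpace F]
    (A : L2 →L[ℂ] F) (a : L2) : A (average ι f a) = ∫ z, (f z : ℂ) • A (translate (ι z) a) := by
  rw [average_apply, ← A.integral_comp_comm (integrable_smul_translate ι f a)]
  simp only [map_smul]

theorem average_average (a : L2) : average ι f (average κ g a)
    = ∫ z : E × E, ((f z.1 * g z.2 : ℝ) : ℂ) • translate (ι z.1 + κ z.2) a := by
  refine Eq.trans ?_ (integral_prod _ (integrable_mul_smul_translate ι κ f g a)).symm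
  refine integral_congr_ae (Eventually.of_forall fun z => ?_)
  have h := map_average κ g (translate (ι z)).toContinuousLinearMap a
  simp only [LinearIsometry.coe_toContinuousLinearMap, translate_translate] at h
  change (f z : ℂ) • translate (ι z) (average κ g a) = _
  rw [h, ← integral_smul]
  simp only [smul_smul, Complex.ofReal_mul]
  rfl

theorem average_comm (a : L2) :
    average ι f (average κ g a) = average κ g (average ι f a) := by
  rw [average_average, average_average]
  refine Eq.trans ?_ (integral_prod_swap (μ := (volume : Measure E)) (ν := (volume : Measure E))
    (fun z : E × E => ((g z.1 * f z.2 : ℝ) : ℂ) • translate (κ z.1 + ι z.2) a))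
  simp only [Prod.fst_swap, Prod.snd_swap, mul_comm, add_comm]
  rfl

theorem inner_average_left (a b : L2) :
    inner ℂ (average ι f a) b = inner ℂ a (average ι f b) := by
  have hexpand : ∀ a b, inner ℂ a (average ι f b)
      = ∫ z, (f z : ℂ) • inner ℂ a (translate (ι z) b) := fun a b =>
    map_average ι f (innerSL ℂ a) b
  rw [← inner_conj_symm, hexpand, hexpand, ← integral_conj, ← integral_neg_eq_self]
  simp only [smul_eq_mul, map_mul, Complex.conj_ofReal, inner_conj_symm, f.even, map_neg,
    inner_translate_left, neg_neg]

/-- Mollification of a kernel in its first variable. -/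
def mollifyFst : L2 →L[ℂ] L2 := average (ContinuousLinearMap.inl ℝ E E) f

theorem mollifyFst_comm (a : L2) : mollifyFst f (mollifyFst g a) = mollifyFst g (mollifyFst f a) :=
  average_comm _ _ _ _ _

/-- Mollification of a kernel in its second variable. -/
def mollifySnd : L2 →L[ℂ] L2 := average (ContinuousLinearMap.inr ℝ E E) f

theorem comp_mollifyFst_left (a b : L2) :
    comp (mollifyFst f a) b = mollifyFst f (comp a b) := by
  refine (map_average (ContinuousLinearMap.inl ℝ E E) f (compL.flip b) a).trans ?_
  simp only [ContinuousLinearMap.flip_apply, compL_apply, ContinuousLinearMap.inl_apply,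
    comp_translate_left]
  rfl

theorem comp_mollifySnd_right (a b : L2) :
    comp a (mollifySnd f b) = mollifySnd f (comp a b) := by
  refine (map_average (ContinuousLinearMap.inr ℝ E E) f (compLeft a) b).trans ?_
  simp only [compLeft_apply, ContinuousLinearMap.inr_apply, comp_translate_right]
  rfl

theorem comp_mollifySnd_left (a b : L2) :
    comp (mollifySnd f a) b = comp a (mollifyFst f b) := by
  refine (map_average (ContinuousLinearMap.inr ℝ E E) f (compL.flip b) a).trans
    (Eq.trans ?_ (map_average (ContinuousLinearMap.inl ℝ E E) f (compLeft a) b).symm)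
  rw [← integral_neg_eq_self]
  simp only [ContinuousLinearMap.flip_apply, compL_apply, compLeft_apply,
    ContinuousLinearMap.inl_apply, ContinuousLinearMap.inr_apply, comp_translate_middle, neg_neg,
    f.even]

theorem adj_mollifyFst (a : L2) : adj (mollifyFst f a) = mollifySnd f (adj a) := by
  have h := adjₗᵢ.toContinuousLinearMap.integral_comp_comm
    (integrable_smul_translate (ContinuousLinearMap.inl ℝ E E) f a)
  refine h.symm.trans (integral_congr_ae (Eventually.of_forall fun z => ?_))
  refine (adj_smul _ _).trans ?_
  rw [adj_translate]
  simp

theorem adj_mollifySnd (a : L2) : adj (mollifySnd f a) = mollifyFst f (adj a) := by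
  rw [← adj_adj (mollifyFst f (adj a)), adj_mollifyFst, adj_adj]

/-- Mollification of a kernel in both variables. -/
def mollify : L2 →L[ℂ] L2 := (mollifyFst f).comp (mollifySnd g)

theorem mollify_apply (a : L2) : mollify f g a = mollifyFst f (mollifySnd g a) := rfl

theorem mollifyFst_mollifySnd_comm (a : L2) :
    mollifyFst f (mollifySnd g a) = mollifySnd g (mollifyFst f a) :=
  average_comm _ _ _ _ _

theorem mollify_comm (f' g' : EvenTestFunction) (a : L2) :
    mollify f g (mollify f' g' a) = mollify f' g' (mollify f g a) := by
  have hsnd : ∀ a, mollifySnd g (mollifySnd g' a) = mollifySnd g' (mollifySnd g a) :=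
    average_comm _ _ _ _
  simp only [mollify_apply]
  rw [← mollifyFst_mollifySnd_comm, hsnd, mollifyFst_comm f f', mollifyFst_mollifySnd_comm f g']

theorem inner_mollify_left (a b : L2) :
    inner ℂ (mollify f g a) b = inner ℂ a (mollify f g b) := by
  rw [mollify_apply, mollify_apply, mollifyFst_mollifySnd_comm]
  exact (inner_average_left _ _ _ _).trans (inner_average_left _ _ _ _)

theorem adj_mollify (a : L2) : adj (mollify f g a) = mollify g f (adj a) := by
  rw [mollify_apply, mollify_apply, adj_mollifyFst, adj_mollifySnd, mollifyFst_mollifySnd_comm]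

theorem comp_mollify (ρ ρ' : EvenTestFunction) (a b : L2) :
    comp (mollify f ρ a) (mollify ρ' g b)
      = mollify f g (comp a (mollifyFst ρ (mollifyFst ρ' b))) := by
  rw [mollify_apply, mollify_apply, mollify_apply, comp_mollifyFst_left, comp_mollifySnd_left,
    mollifyFst_mollifySnd_comm ρ' g, mollifyFst_mollifySnd_comm ρ g, comp_mollifySnd_right]

end Average

section TensorTest

variable (f g : EvenTestFunction)

/-- The test function `(x, y) ↦ f (x - x₀) g (y - y₀)` centred at `q = (x₀, y₀)`; pairing a kernel
with it evaluates the mollified kernel at `q`. -/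
def tensorTest (q : E × E) : E × E → ℂ :=
  fun z => ((f (z.1 - q.1) * g (z.2 - q.2) : ℝ) : ℂ)

theorem isTest_tensorTest (q : E × E) : IsTest (tensorTest f g q) := by
  refine ⟨Complex.ofRealCLM.contDiff.comp (ContDiff.mul (f.contDiff.comp (by fun_prop))
    (g.contDiff.comp (by fun_prop))), ?_⟩
  have hf : HasCompactSupport fun x => f (x - q.1) :=
    f.hasCompactSupport.comp_homeomorph (Homeomorph.subRight q.1)
  have hg : HasCompactSupport fun x => g (x - q.2) :=
    g.hasCompactSupport.comp_homeomorph (Homeomorph.subRight q.2)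
  refine HasCompactSupport.intro (hf.isCompact.prod hg.isCompact) fun z hz => ?_
  rw [Set.mem_prod, not_and_or] at hz
  rcases hz with hz | hz
  · simp [tensorTest, image_eq_zero_of_notMem_tsupport hz]
  · simp [tensorTest, image_eq_zero_of_notMem_tsupport hz]

theorem lapX_tensorTest (q : E × E) : lapX (tensorTest f g q) = tensorTest f.lap g q := by
  ext z
  have h := f.laplacian_const_mul_comp_sub (g (z.2 - q.2)) q.1 z.1
  simpa only [lapX, tensorTest, mul_comm] using h

theorem lapY_tensorTest (q : E × E) : lapY (tensorTest f g q) = tensorTest f g.lap q := by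
  ext z
  exact g.laplacian_const_mul_comp_sub (f (z.1 - q.1)) q.2 z.2

theorem integral_mul_translate_mul_star_eq_pair (a χ : L2) (q : E × E) :
    ∫ z : E × E, ((f z.1 * g z.2 : ℝ) : ℂ) * (a (q - z) * star (χ q))
      = pair a (tensorTest f g q) * star (χ q) := by
  rw [pair, ← integral_mul_const, ← integral_sub_left_eq_self _ _ q]
  refine integral_congr_ae (Eventually.of_forall fun z => ?_)
  simp only [tensorTest, sub_sub_cancel, Prod.fst_sub, Prod.snd_sub]
  rw [← f.even, ← g.even, neg_sub, neg_sub]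
  ring

theorem integrable_pair_tensorTest_mul_star (a χ : L2) :
    Integrable fun q => pair a (tensorTest f g q) * star (χ q) :=
  (integrable_mul_translate_mul_star (f.integrable.mul_prod g.integrable)
    (by fun_prop) a χ).integral_prod_right.congr
    (Eventually.of_forall (integral_mul_translate_mul_star_eq_pair f g a χ))

theorem inner_mollify_right (a χ : L2) :
    inner ℂ χ (mollify f g a) = ∫ q, pair a (tensorTest f g q) * star (χ q) := by
  have h := (innerSL ℂ χ).integral_comp_comm (integrable_mul_smul_translate
    (ContinuousLinearMap.inl ℝ E E) (ContinuousLinearMap.inr ℝ E E) f g a)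
  simp only [ContinuousLinearMap.inl_apply, ContinuousLinearMap.inr_apply, Prod.mk_add_mk,
    add_zero, zero_add, innerSL_apply_apply, inner_smul_right, inner_translate_right,
    ← integral_const_mul] at h
  calc inner ℂ χ (mollify f g a) = _ := by
        rw [mollify_apply, mollifyFst, mollifySnd, average_average]
        simp only [ContinuousLinearMap.inl_apply, ContinuousLinearMap.inr_apply, Prod.mk_add_mk,
          add_zero, zero_add]
        exact h.symm
    _ = _ := integral_integral_swap
        (integrable_mul_translate_mul_star (f.integrable.mul_prod g.integrable) (by fun_prop) a χ)
    _ = _ := integral_congr_ae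
        (Eventually.of_forall (integral_mul_translate_mul_star_eq_pair f g a χ))

theorem mollify_eq_of_pair_tensorTest_eq {f g} {D U : L2} {α β : ℂ}
    (h : ∀ q, pair D (tensorTest f g q)
      = α * pair U (tensorTest f.lap g q) + β * pair U (tensorTest f g.lap q)) :
    mollify f g D = (α • mollify f.lap g + β • mollify f g.lap) U := by
  refine ext_inner_left ℂ fun χ => ?_
  rw [add_apply, smul_apply, smul_apply, inner_add_right, inner_smul_right, inner_smul_right,
    inner_mollify_right, inner_mollify_right, inner_mollify_right, ← integral_const_mul,
    ← integral_const_mul, ← integral_add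
      ((integrable_pair_tensorTest_mul_star f.lap g U χ).const_mul _)
      ((integrable_pair_tensorTest_mul_star f g.lap U χ).const_mul _)]
  simp only [h, add_mul, mul_assoc]

end TensorTest

theorem tendsto_apply_apply_of_norm_le {F : Type*} [NormedAddCommGroup F] [NormedSpace ℂ F]
    {A B : ℕ → F →L[ℂ] F} (hA : ∀ n a, ‖A n a‖ ≤ ‖a‖) {a : F}
    (hAa : Tendsto (fun n => A n a) atTop (𝓝 a)) (hBa : Tendsto (fun n => B n a) atTop (𝓝 a)) :
    Tendsto (fun n => A n (B n a)) atTop (𝓝 a) := by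
  have herr : Tendsto (fun n => A n (B n a - a)) atTop (𝓝 0) :=
    squeeze_zero_norm (fun n => hA n _) (tendsto_iff_norm_sub_tendsto_zero.mp hBa)
  simpa using herr.add hAa

/-- Smooth bumps concentrating at the origin. -/
def bump (n : ℕ) : ContDiffBump (0 : E) where
  rIn := 1 / (2 * (n + 1))
  rOut := 1 / (n + 1)
  rIn_pos := by positivity
  rIn_lt_rOut := by
    have : (0 : ℝ) < n + 1 := by positivity
    gcongr
    linarith

/-- An approximate identity made of even test functions. -/
def mollifier (n : ℕ) : EvenTestFunction where
  toFun := (bump n).normed volume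
  contDiff := (bump n).contDiff_normed
  hasCompactSupport := (bump n).hasCompactSupport_normed
  even := (bump n).normed_neg

section Mollifier

variable (ι : E →L[ℝ] E × E)

theorem integral_abs_mollifier (n : ℕ) : ∫ z, |mollifier n z| = 1 := by
  rw [← (bump n).integral_normed (μ := (volume : Measure E))]
  exact integral_congr_ae (Eventually.of_forall fun z => abs_of_nonneg ((bump n).nonneg_normed z))

theorem norm_average_mollifier_le (n : ℕ) (a : L2) : ‖average ι (mollifier n) a‖ ≤ ‖a‖ := by
  simpa only [integral_abs_mollifier, one_mul] using norm_average_le ι (mollifier n) a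

theorem tendsto_average_mollifier (a : L2) :
    Tendsto (fun n => average ι (mollifier n) a) atTop (𝓝 a) := by
  have hrOut : Tendsto (fun n => (bump n).rOut) atTop (𝓝 0) :=
    tendsto_one_div_add_atTop_nhds_zero_nat
  have hcont : Continuous fun z : E => translate (ι (-z)) a :=
    (continuous_translate a).comp (by fun_prop)
  have h := ContDiffBump.convolution_tendsto_right_of_continuous (μ := (volume : Measure E))
    hrOut hcont 0
  simp only [neg_zero, map_zero, translate_zero] at h
  refine h.congr fun n => integral_congr_ae (Eventually.of_forall fun z => ?_)
  simp only [zero_sub, neg_neg, ContinuousLinearMap.lsmul_apply, real_smul_L2]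
  rfl

theorem norm_mollify_mollifier_le (n : ℕ) (a : L2) :
    ‖mollify (mollifier n) (mollifier n) a‖ ≤ ‖a‖ :=
  (norm_average_mollifier_le _ n _).trans (norm_average_mollifier_le _ n _)

theorem tendsto_mollify_mollifier (a : L2) :
    Tendsto (fun n => mollify (mollifier n) (mollifier n) a) atTop (𝓝 a) :=
  tendsto_apply_apply_of_norm_le (norm_average_mollifier_le _) (tendsto_average_mollifier _ a)
    (tendsto_average_mollifier _ a)

theorem norm_mollifyFst_mollifyFst_mollifier_le (n : ℕ) (a : L2) :
    ‖mollifyFst (mollifier n) (mollifyFst (mollifier n) a)‖ ≤ ‖a‖ :=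
  (norm_average_mollifier_le _ n _).trans (norm_average_mollifier_le _ n _)

theorem tendsto_mollifyFst_mollifyFst_mollifier (a : L2) :
    Tendsto (fun n => mollifyFst (mollifier n) (mollifyFst (mollifier n) a)) atTop (𝓝 a) :=
  tendsto_apply_apply_of_norm_le (norm_average_mollifier_le _) (tendsto_average_mollifier _ a)
    (tendsto_average_mollifier _ a)

end Mollifier

theorem IsTest.memLp {ψ : E × E → ℂ} (h : IsTest ψ) : MemLp ψ 2 volume :=
  h.1.continuous.memLp_of_hasCompactSupport h.2

/-! ### Mollified Schrödinger equations for kernels -/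

section MollifiedLaplacian

variable (α β γ : ℝ) (f g ρ ρ' : EvenTestFunction) (a b A B : L2)

/-- The operator `α Δ_x + β Δ_y` on mollified kernels, with the Laplacians carried by the
mollifiers. -/
def mollifiedLaplacian : L2 →L[ℂ] L2 :=
  (α : ℂ) • mollify f.lap g + (β : ℂ) • mollify f g.lap

theorem mollifiedLaplacian_apply : mollifiedLaplacian α β f g a
    = (α : ℂ) • mollify f.lap g a + (β : ℂ) • mollify f g.lap a := rfl

attribute [local irreducible] EvenTestFunction.lap mollifiedLaplacian mollify mollifyFst mollifySnd
  comp adj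

theorem mollifiedLaplacian_neg :
    mollifiedLaplacian (-α) (-β) f g a = -mollifiedLaplacian α β f g a := by
  simp only [mollifiedLaplacian_apply, Complex.ofReal_neg, neg_smul, neg_add]

theorem adj_mollifiedLaplacian :
    adj (mollifiedLaplacian α β f g a) = mollifiedLaplacian β α g f (adj a) := by
  simp only [mollifiedLaplacian_apply, adj_add, adj_smul, adj_mollify, Complex.star_def,
    Complex.conj_ofReal, add_comm]

theorem im_inner_mollify_mollifiedLaplacian :
    (inner ℂ (mollify f g a) (mollifiedLaplacian α β f g a)).im = 0 := by
  have hreal : ∀ f' g', (inner ℂ (mollify f g a) (mollify f' g' a)).im = 0 := fun f' g' => by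
    rw [← Complex.conj_eq_iff_im, inner_conj_symm, inner_mollify_left, mollify_comm,
      ← inner_mollify_left]
  simp only [mollifiedLaplacian_apply, inner_add_right, inner_smul_right, Complex.add_im,
    Complex.im_ofReal_mul, hreal, mul_zero, add_zero]

theorem comp_mollifiedLaplacian_mollify :
    comp (mollifiedLaplacian α β f ρ a) (mollify ρ' g b)
      = (α : ℂ) • mollify f.lap g (comp a (mollifyFst ρ (mollifyFst ρ' b)))
        + (β : ℂ) • mollify f g (comp a (mollifyFst ρ.lap (mollifyFst ρ' b))) := by
  simp only [mollifiedLaplacian_apply, comp_add_left, comp_smul_left, comp_mollify]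

theorem comp_mollify_mollifiedLaplacian :
    comp (mollify f ρ a) (mollifiedLaplacian α β ρ' g b)
      = (α : ℂ) • mollify f g (comp a (mollifyFst ρ (mollifyFst ρ'.lap b)))
        + (β : ℂ) • mollify f g.lap (comp a (mollifyFst ρ (mollifyFst ρ' b))) := by
  simp only [mollifiedLaplacian_apply, comp_add_right, comp_smul_right, comp_mollify]

-- The Laplacians in the contracted variable cancel because the two factors carry opposite signs.
theorem comp_mollifiedLaplacian_add_comp_mollifiedLaplacian_neg :
    comp (mollifiedLaplacian α β f ρ a) (mollify ρ g b)
      + comp (mollify f ρ a) (mollifiedLaplacian (-β) γ ρ g b)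
    = mollifiedLaplacian α γ f g (comp a (mollifyFst ρ (mollifyFst ρ b))) := by
  rw [comp_mollifiedLaplacian_mollify, comp_mollify_mollifiedLaplacian]
  simp only [mollifyFst_comm ρ.lap ρ, mollifiedLaplacian_apply, Complex.ofReal_neg, neg_smul]
  abel

theorem comp_smul_mollifiedLaplacian_add_mollify (c : ℂ) :
    comp (c • (mollifiedLaplacian α β f ρ a + mollify f ρ A)) (mollify ρ g b)
      + comp (mollify f ρ a) (c • (mollifiedLaplacian (-β) γ ρ g b + mollify ρ g B))
    = c • (mollifiedLaplacian α γ f g (comp a (mollifyFst ρ (mollifyFst ρ b)))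
      + mollify f g (comp A (mollifyFst ρ (mollifyFst ρ b))
        + comp a (mollifyFst ρ (mollifyFst ρ B)))) := by
  simp only [comp_smul_left, comp_smul_right, ← smul_add, comp_add_left, comp_add_right,
    ← comp_mollifiedLaplacian_add_comp_mollifiedLaplacian_neg α β γ, comp_mollify,
    map_add (mollify f g)]
  exact congrArg (c • ·) (add_add_add_comm _ _ _ _)

theorem intervalIntegral_map_add_map (P Q : L2 →L[ℂ] L2) {x y : ℝ → L2} {s t : ℝ}
    (hx : IntervalIntegrable x volume s t) (hy : IntervalIntegrable y volume s t) :
    ∫ r in s..t, (P (x r) + Q (y r)) = P (∫ r in s..t, x r) + Q (∫ r in s..t, y r) := by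
  rw [intervalIntegral.integral_add ⟨P.integrable_comp hx.1, P.integrable_comp hx.2⟩
    ⟨Q.integrable_comp hy.1, Q.integrable_comp hy.2⟩, P.intervalIntegral_comp_comm hx,
    Q.intervalIntegral_comp_comm hy]

end MollifiedLaplacian

/-- Composition of kernels as a real bilinear map. -/
abbrev compLReal : L2 →L[ℝ] L2 →L[ℝ] L2 := compL.bilinearRestrictScalars ℝ

theorem continuousOn_comp {x y : ℝ → L2} {S : Set ℝ} (hx : ContinuousOn x S)
    (hy : ContinuousOn y S) : ContinuousOn (fun r => comp (x r) (y r)) S :=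
  compLReal.continuous₂.comp_continuousOn (hx.prodMk hy)

theorem integrableOn_comp_left {x y : ℝ → L2} {s t : ℝ} (hx : IntegrableOn x (Icc s t))
    (hy : ContinuousOn y (Icc s t)) : IntegrableOn (fun r => comp (x r) (y r)) (Icc s t) :=
  integrableOn_bilinear_continuousOn compLReal isCompact_Icc hx hy

theorem integrableOn_comp_right {x y : ℝ → L2} {s t : ℝ} (hx : ContinuousOn x (Icc s t))
    (hy : IntegrableOn y (Icc s t)) : IntegrableOn (fun r => comp (x r) (y r)) (Icc s t) :=
  integrableOn_bilinear_continuousOn compLReal.flip isCompact_Icc hy hx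

theorem tendsto_integral_comp_mollifyFst_mollifyFst {x y : ℝ → L2} {s t : ℝ}
    (hx : IntervalIntegrable x volume s t) (hy : IntervalIntegrable y volume s t)
    (hxy : IntervalIntegrable (fun r => ‖x r‖ * ‖y r‖) volume s t) :
    Tendsto (fun n => ∫ r in s..t,
        comp (x r) (mollifyFst (mollifier n) (mollifyFst (mollifier n) (y r)))) atTop
      (𝓝 (∫ r in s..t, comp (x r) (y r))) :=
  tendsto_integral_bilinear compLReal
    (fun n => ((mollifyFst (mollifier n)).comp (mollifyFst (mollifier n))).continuous)
    norm_mollifyFst_mollifyFst_mollifier_le tendsto_mollifyFst_mollifyFst_mollifier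
    hx.def'.aestronglyMeasurable hy.def'.aestronglyMeasurable hxy

/-- The real part of the inner product as a real bilinear form. -/
def reInner : L2 →L[ℝ] L2 →L[ℝ] ℝ :=
  (ContinuousLinearMap.compL ℝ L2 ℂ ℝ Complex.reCLM).comp
    (isBoundedBilinearMap_inner (𝕜 := ℂ) (E := L2)).toContinuousLinearMap

theorem reInner_apply (x y : L2) : reInner x y = (inner ℂ x y).re := rfl

theorem reInner_comm (x y : L2) : reInner x y = reInner y x :=
  inner_re_symm (𝕜 := ℂ) x y

theorem reInner_self (x : L2) : reInner x x = ‖x‖ ^ 2 :=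
  (norm_sq_eq_re_inner (𝕜 := ℂ) x).symm

theorem reInner_neg_I_smul (x y : L2) : reInner x (-Complex.I • y) = (inner ℂ x y).im := by
  simp [reInner_apply, inner_smul_right]

/-- The equation `i a_t - α Δ_x a - β Δ_y a = A` on `[0, T]`. It is stated after mollification in
space and integration in time, which avoids unbounded operators. -/
structure IsSchrodinger (T α β : ℝ) (a A : ℝ → L2) : Prop where
  continuousOn : ContinuousOn a (Icc 0 T)
  integrableOn_source : IntegrableOn A (Icc 0 T)
  smul_mollify_sub : ∀ f g : EvenTestFunction, ∀ t ∈ Icc 0 T, Complex.I • mollify f g (a t - a 0)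
    = mollifiedLaplacian α β f g (∫ s in (0 : ℝ)..t, a s) + mollify f g (∫ s in (0 : ℝ)..t, A s)

namespace IsSchrodinger

attribute [local irreducible] mollifiedLaplacian mollify mollifyFst mollifySnd comp adj
  EvenTestFunction.lap

variable {T α β γ t : ℝ} {a b A B : ℝ → L2}

theorem integrableOn (ha : IsSchrodinger T α β a A) : IntegrableOn a (Icc 0 T) :=
  ha.continuousOn.integrableOn_Icc

theorem intervalIntegrable (ha : IsSchrodinger T α β a A) (ht : t ∈ Icc 0 T) :
    IntervalIntegrable a volume 0 t :=
  intervalIntegrable_of_integrableOn_Icc ha.integrableOn ht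

theorem intervalIntegrable_source (ha : IsSchrodinger T α β a A) (ht : t ∈ Icc 0 T) :
    IntervalIntegrable A volume 0 t :=
  intervalIntegrable_of_integrableOn_Icc ha.integrableOn_source ht

theorem add (ha : IsSchrodinger T α β a A) (hb : IsSchrodinger T α β b B) :
    IsSchrodinger T α β (fun s => a s + b s) (fun s => A s + B s) where
  continuousOn := ha.continuousOn.add hb.continuousOn
  integrableOn_source := ha.integrableOn_source.add hb.integrableOn_source
  smul_mollify_sub f g t ht := by
    simp only [intervalIntegral.integral_add (ha.intervalIntegrable ht) (hb.intervalIntegrable ht),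
      intervalIntegral.integral_add (ha.intervalIntegrable_source ht)
        (hb.intervalIntegrable_source ht), add_sub_add_comm, map_add, smul_add,
      ha.smul_mollify_sub f g t ht, hb.smul_mollify_sub f g t ht]
    exact add_add_add_comm _ _ _ _

theorem adjoint (ha : IsSchrodinger T α β a A) :
    IsSchrodinger T (-β) (-α) (fun s => adj (a s)) (fun s => -adj (A s)) where
  continuousOn := adjₗᵢ.continuous.comp_continuousOn ha.continuousOn
  integrableOn_source := (adjₗᵢ.toContinuousLinearMap.integrable_comp ha.integrableOn_source).neg
  smul_mollify_sub f g t ht := by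
    have ha' : ∫ s in (0 : ℝ)..t, adj (a s) = adj (∫ s in (0 : ℝ)..t, a s) :=
      adjₗᵢ.toContinuousLinearMap.intervalIntegral_comp_comm (ha.intervalIntegrable ht)
    have hA' : ∫ s in (0 : ℝ)..t, adj (A s) = adj (∫ s in (0 : ℝ)..t, A s) :=
      adjₗᵢ.toContinuousLinearMap.intervalIntegral_comp_comm (ha.intervalIntegrable_source ht)
    have hadj := congrArg adj (ha.smul_mollify_sub g f t ht)
    simp only [adj_add, adj_mollifiedLaplacian, adj_mollify, adj_smul, adj_sub, Complex.star_def,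
      Complex.conj_I, neg_smul, neg_eq_iff_eq_neg, neg_add] at hadj
    simp only [intervalIntegral.integral_neg, ha', hA', mollifiedLaplacian_neg, map_neg, hadj]

theorem mollify_eq (ha : IsSchrodinger T α β a A) (f g : EvenTestFunction) (ht : t ∈ Icc 0 T) :
    mollify f g (a t) = mollify f g (a 0)
      + ∫ s in (0 : ℝ)..t, -Complex.I • (mollifiedLaplacian α β f g (a s) + mollify f g (A s)) := by
  rw [intervalIntegral.integral_smul, intervalIntegral_map_add_map _ _ (ha.intervalIntegrable ht)
    (ha.intervalIntegrable_source ht), ← ha.smul_mollify_sub f g t ht]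
  simp only [smul_smul, map_sub, neg_mul, Complex.I_mul_I, neg_neg, one_smul, add_sub_cancel]

theorem intervalIntegrable_deriv (ha : IsSchrodinger T α β a A) (f g : EvenTestFunction)
    (ht : t ∈ Icc 0 T) : IntervalIntegrable
      (fun s => -Complex.I • (mollifiedLaplacian α β f g (a s) + mollify f g (A s))) volume 0 t :=
  intervalIntegrable_of_integrableOn_Icc
    ((((mollifiedLaplacian α β f g).integrable_comp ha.integrableOn).add
      ((mollify f g).integrable_comp ha.integrableOn_source)).smul (-Complex.I)) ht

theorem of_tendsto {a' A' : ℕ → ℝ → L2} (h : ∀ n, IsSchrodinger T α β (a' n) (A' n))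
    (ha : ContinuousOn a (Icc 0 T)) (hA : IntegrableOn A (Icc 0 T))
    (h_tendsto : ∀ t ∈ Icc 0 T, Tendsto (fun n => a' n t) atTop (𝓝 (a t)))
    (h_integral : ∀ t ∈ Icc 0 T,
      Tendsto (fun n => ∫ s in (0 : ℝ)..t, a' n s) atTop (𝓝 (∫ s in (0 : ℝ)..t, a s)))
    (h_source : ∀ t ∈ Icc 0 T,
      Tendsto (fun n => ∫ s in (0 : ℝ)..t, A' n s) atTop (𝓝 (∫ s in (0 : ℝ)..t, A s))) :
    IsSchrodinger T α β a A where
  continuousOn := ha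
  integrableOn_source := hA
  smul_mollify_sub f g t ht := by
    have h0 : (0 : ℝ) ∈ Icc 0 T := ⟨le_rfl, ht.1.trans ht.2⟩
    have hleft := (((mollify f g).continuous.tendsto _).comp
      ((h_tendsto t ht).sub (h_tendsto 0 h0))).const_smul Complex.I
    have hright := (((mollifiedLaplacian α β f g).continuous.tendsto _).comp
      (h_integral t ht)).add (((mollify f g).continuous.tendsto _).comp (h_source t ht))
    exact tendsto_nhds_unique hleft
      (hright.congr fun n => ((h n).smul_mollify_sub f g t ht).symm)

theorem comp_mollifyFst_mollifyFst (ha : IsSchrodinger T α β a A)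
    (hb : IsSchrodinger T (-β) γ b B) (ρ : EvenTestFunction) :
    IsSchrodinger T α γ (fun s => comp (a s) (mollifyFst ρ (mollifyFst ρ (b s))))
      (fun s => comp (A s) (mollifyFst ρ (mollifyFst ρ (b s)))
        + comp (a s) (mollifyFst ρ (mollifyFst ρ (B s)))) := by
  let Q : L2 →L[ℂ] L2 := (mollifyFst ρ).comp (mollifyFst ρ)
  let X : ℝ → L2 := fun s => comp (a s) (Q (b s))
  let Y : ℝ → L2 := fun s =>
    comp (A s) (Q (b s)) + comp (a s) (Q (B s))
  have hQb : ContinuousOn (fun s => Q (b s)) (Icc 0 T) :=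
    Q.continuous.comp_continuousOn hb.continuousOn
  have hX : ContinuousOn X (Icc 0 T) :=
    continuousOn_comp ha.continuousOn hQb
  have hY : IntegrableOn Y (Icc 0 T) :=
    (integrableOn_comp_left ha.integrableOn_source hQb).add
      (integrableOn_comp_right ha.continuousOn (Q.integrable_comp hb.integrableOn_source))
  refine ⟨hX, hY, fun f g t ht => ?_⟩
  have hsub : ∀ s ∈ uIcc 0 t, s ∈ Icc 0 T := fun s hs => by
    rw [uIcc_of_le ht.1] at hs
    exact ⟨hs.1, hs.2.trans ht.2⟩
  have hprod := integral_bilinear_deriv_add_eq_sub compLReal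
    (ha.intervalIntegrable_deriv f ρ ht) (hb.intervalIntegrable_deriv ρ g ht)
    (fun s hs => ha.mollify_eq f ρ (hsub s hs)) (fun s hs => hb.mollify_eq ρ g (hsub s hs))
  have hderiv : mollify f g (X t) - mollify f g (X 0) = ∫ s in (0 : ℝ)..t,
      -Complex.I • (mollifiedLaplacian α γ f g (X s) + mollify f g (Y s)) :=
    calc mollify f g (X t) - mollify f g (X 0)
        = comp (mollify f ρ (a t)) (mollify ρ g (b t))
          - comp (mollify f ρ (a 0)) (mollify ρ g (b 0)) :=
        congrArg₂ _ (comp_mollify f g ρ ρ _ _).symm (comp_mollify f g ρ ρ _ _).symm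
      _ = _ := hprod.symm
      _ = _ := intervalIntegral.integral_congr fun s _ =>
        comp_smul_mollifiedLaplacian_add_mollify α β γ f g ρ _ _ _ _ _
  change Complex.I • mollify f g (X t - X 0) = mollifiedLaplacian α γ f g (∫ s in (0 : ℝ)..t, X s)
    + mollify f g (∫ s in (0 : ℝ)..t, Y s)
  rw [map_sub, hderiv, intervalIntegral.integral_smul, intervalIntegral_map_add_map _ _
    (intervalIntegrable_of_integrableOn_Icc hX.integrableOn_Icc ht)
    (intervalIntegrable_of_integrableOn_Icc hY ht), smul_smul, mul_neg, Complex.I_mul_I, neg_neg,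
    one_smul]

protected theorem comp (ha : IsSchrodinger T α β a A) (hb : IsSchrodinger T (-β) γ b B) :
    IsSchrodinger T α γ (fun s => comp (a s) (b s))
      (fun s => comp (A s) (b s) + comp (a s) (B s)) := by
  let Q : ℕ → L2 →L[ℂ] L2 := fun n => (mollifyFst (mollifier n)).comp (mollifyFst (mollifier n))
  have hQb : ∀ n, ContinuousOn (fun s => Q n (b s)) (Icc 0 T) := fun n =>
    (Q n).continuous.comp_continuousOn hb.continuousOn
  have hAb := integrableOn_comp_left ha.integrableOn_source hb.continuousOn
  have haB := integrableOn_comp_right ha.continuousOn hb.integrableOn_source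
  refine .of_tendsto (fun n => ha.comp_mollifyFst_mollifyFst hb (mollifier n))
    (continuousOn_comp ha.continuousOn hb.continuousOn)
    (hAb.add haB)
    (fun t _ => ((compLeft (a t)).continuous.tendsto _).comp
      (tendsto_mollifyFst_mollifyFst_mollifier (b t)))
    (fun t ht => tendsto_integral_comp_mollifyFst_mollifyFst (ha.intervalIntegrable ht)
      (hb.intervalIntegrable ht) (intervalIntegrable_of_integrableOn_Icc
        (ha.continuousOn.norm.mul hb.continuousOn.norm).integrableOn_Icc ht)) fun t ht => ?_
  have hlim := (tendsto_integral_comp_mollifyFst_mollifyFst (ha.intervalIntegrable_source ht)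
      (hb.intervalIntegrable ht) (intervalIntegrable_of_integrableOn_Icc
        (IntegrableOn.mul_continuousOn ha.integrableOn_source.norm hb.continuousOn.norm
          isCompact_Icc) ht)).add
    (tendsto_integral_comp_mollifyFst_mollifyFst (ha.intervalIntegrable ht)
      (hb.intervalIntegrable_source ht) (intervalIntegrable_of_integrableOn_Icc
        (IntegrableOn.continuousOn_mul ha.continuousOn.norm hb.integrableOn_source.norm
          isCompact_Icc) ht))
  rw [intervalIntegral.integral_add (intervalIntegrable_of_integrableOn_Icc hAb ht)
    (intervalIntegrable_of_integrableOn_Icc haB ht)]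
  exact hlim.congr fun n => (intervalIntegral.integral_add
    (intervalIntegrable_of_integrableOn_Icc
      (integrableOn_comp_left ha.integrableOn_source (hQb n)) ht)
    (intervalIntegrable_of_integrableOn_Icc (integrableOn_comp_right ha.continuousOn
      ((Q n).integrable_comp hb.integrableOn_source)) ht)).symm

theorem ae_eq (hA : IsSchrodinger T α β a A) (hB : IsSchrodinger T α β b B)
    (hab : ∀ t ∈ Icc 0 T, a t = b t) : A =ᵐ[volume.restrict (Icc 0 T)] B := by
  refine ae_eq_of_integral_eq hA.integrableOn_source hB.integrableOn_source fun t ht => ?_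
  have h0 : (0 : ℝ) ∈ Icc 0 T := ⟨le_rfl, ht.1.trans ht.2⟩
  have h_int : ∫ s in (0 : ℝ)..t, a s = ∫ s in (0 : ℝ)..t, b s :=
    intervalIntegral.integral_congr fun s hs => by
      rw [uIcc_of_le ht.1] at hs
      exact hab s ⟨hs.1, hs.2.trans ht.2⟩
  refine tendsto_nhds_unique ((tendsto_mollify_mollifier _).congr fun n => ?_)
    (tendsto_mollify_mollifier _)
  have h := hA.smul_mollify_sub (mollifier n) (mollifier n) t ht
  rw [hab t ht, hab 0 h0, hB.smul_mollify_sub _ _ t ht, h_int] at h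
  exact (add_left_cancel h).symm

theorem norm_mollify_sq_sub (ha : IsSchrodinger T α β a A) (ht : t ∈ Icc 0 T)
    (f g : EvenTestFunction) : ‖mollify f g (a t)‖ ^ 2 - ‖mollify f g (a 0)‖ ^ 2
      = 2 * ∫ s in (0 : ℝ)..t, reInner (a s) (mollify f g (mollify f g (-Complex.I • A s))) := by
  have hsub : ∀ s ∈ uIcc 0 t, s ∈ Icc 0 T := fun s hs => by
    rw [uIcc_of_le ht.1] at hs
    exact ⟨hs.1, hs.2.trans ht.2⟩
  have hprod := integral_bilinear_deriv_add_eq_sub reInner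
    (ha.intervalIntegrable_deriv f g ht) (ha.intervalIntegrable_deriv f g ht)
    (fun s hs => ha.mollify_eq f g (hsub s hs)) (fun s hs => ha.mollify_eq f g (hsub s hs))
  rw [reInner_self, reInner_self] at hprod
  refine hprod.symm.trans (Eq.trans ?_ (intervalIntegral.integral_const_mul _ _))
  refine intervalIntegral.integral_congr fun s _ => ?_
  have hlap := im_inner_mollify_mollifiedLaplacian α β f g (a s)
  simp only [reInner_comm _ (mollify f g (a s)), ← two_mul, reInner_neg_I_smul, inner_add_right,
    Complex.add_im, hlap, zero_add, map_smul]
  rw [inner_mollify_left]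

theorem norm_sq_sub (ha : IsSchrodinger T α β a A) (ht : t ∈ Icc 0 T) :
    ‖a t‖ ^ 2 - ‖a 0‖ ^ 2 = 2 * ∫ s in (0 : ℝ)..t, (inner ℂ (a s) (A s)).im := by
  let J : ℕ → L2 →L[ℂ] L2 := fun n => mollify (mollifier n) (mollifier n)
  have hJ : ∀ c, Tendsto (fun n => J n c) atTop (𝓝 c) := tendsto_mollify_mollifier
  have hJ_norm : ∀ n c, ‖J n c‖ ≤ ‖c‖ := norm_mollify_mollifier_le
  have hJJ : ∀ c, Tendsto (fun n => J n (J n c)) atTop (𝓝 c) :=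
    fun c => tendsto_apply_apply_of_norm_le hJ_norm (hJ c) (hJ c)
  have hA : IntegrableOn (fun s => -Complex.I • A s) (Icc 0 T) :=
    ha.integrableOn_source.smul (-Complex.I)
  have hlim := tendsto_integral_bilinear reInner (fun n => ((J n).comp (J n)).continuous)
    (fun n c => (hJ_norm n _).trans (hJ_norm n c)) hJJ
    (ha.intervalIntegrable ht).def'.aestronglyMeasurable
    (intervalIntegrable_of_integrableOn_Icc hA ht).def'.aestronglyMeasurable
    (intervalIntegrable_of_integrableOn_Icc
      (IntegrableOn.continuousOn_mul ha.continuousOn.norm hA.norm isCompact_Icc) ht)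
  simp only [reInner_neg_I_smul] at hlim
  exact tendsto_nhds_unique (((hJ (a t)).norm.pow 2).sub ((hJ (a 0)).norm.pow 2))
    ((hlim.const_mul 2).congr fun n => (ha.norm_mollify_sq_sub ht _ _).symm)

end IsSchrodinger

/-! ### Measurability of kernel-valued functions -/

instance : SecondCountableTopology L2 := by
  have : IsSeparable (volume : Measure (E × E)) :=
    @instIsSeparableOfCountablyGeneratedOfSFinite _ _ _ inferInstance inferInstance
  have : Fact ((2 : ℝ≥0∞) ≠ ⊤) := ⟨by norm_num⟩
  exact Lp.SecondCountableTopology (μ := (volume : Measure (E × E)))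

theorem stronglyMeasurable_of_measurable_dist {Ω X : Type*} [MeasurableSpace Ω]
    [PseudoMetricSpace X] [SecondCountableTopology X] {f : Ω → X}
    (hf : ∀ a, Measurable fun s => dist (f s) a) : StronglyMeasurable f := by
  borelize X
  have hbasis : TopologicalSpace.IsTopologicalBasis
      (range fun c : X × ℝ => Metric.ball c.1 c.2) := by
    refine TopologicalSpace.isTopologicalBasis_of_isOpen_of_nhds ?_ fun a u ha hu => ?_
    · rintro _ ⟨c, rfl⟩
      exact Metric.isOpen_ball
    · obtain ⟨r, hr, h⟩ := Metric.isOpen_iff.1 hu a ha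
      exact ⟨_, mem_range_self (a, r), Metric.mem_ball_self hr, h⟩
  have hf_meas : Measurable[_, borel X] f := by
    rw [hbasis.borel_eq_generateFrom]
    refine measurable_generateFrom ?_
    rintro _ ⟨c, rfl⟩
    exact measurableSet_lt (hf c.1) measurable_const
  exact hf_meas.stronglyMeasurable

theorem measurable_eLpNorm {Ω X F : Type*} [MeasurableSpace Ω] [MeasurableSpace X]
    [NormedAddCommGroup F] [MeasurableSpace F] [OpensMeasurableSpace F] {μ : Measure X} [SFinite μ]
    {p : ℝ≥0∞} (hp : p ≠ 0) (hp_top : p ≠ ⊤) {f : Ω → X → F}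
    (hf : Measurable (Function.uncurry f)) : Measurable fun s => eLpNorm (f s) p μ := by
  simp only [eLpNorm_eq_lintegral_rpow_enorm_toReal hp hp_top]
  exact (Measurable.lintegral_prod_right' (hf.enorm.pow_const _)).pow_const _

theorem coeFn_toL2 {f : E × E → ℂ} (h : MemLp f 2 volume) : toL2 f =ᵐ[volume] f := by
  rw [toL2, dif_pos h]
  exact h.coeFn_toLp

theorem toL2_of_not_memLp {f : E × E → ℂ} (h : ¬ MemLp f 2 volume) : toL2 f = 0 := dif_neg h

theorem stronglyMeasurable_toL2 {Ω : Type*} [MeasurableSpace Ω] {f : Ω → E × E → ℂ}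
    (hf : Measurable (Function.uncurry f)) : StronglyMeasurable fun s => toL2 (f s) := by
  refine stronglyMeasurable_of_measurable_dist fun a => ?_
  have hfs : ∀ s, Measurable (f s) := fun s => hf.comp measurable_prodMk_left
  have hfa : Measurable (Function.uncurry fun s q => f s q - a q) :=
    hf.sub ((Lp.stronglyMeasurable a).measurable.comp measurable_snd)
  have hS : MeasurableSet {s | eLpNorm (f s) 2 volume < ⊤} :=
    measurableSet_lt (measurable_eLpNorm two_ne_zero ENNReal.ofNat_ne_top hf) measurable_const
  classical
  have hdist : (fun s => dist (toL2 (f s)) a) = {s | eLpNorm (f s) 2 volume < ⊤}.piecewise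
      (fun s => (eLpNorm (fun q => f s q - a q) 2 volume).toReal) (fun _ => dist 0 a) := by
    ext s
    by_cases hs : s ∈ {s | eLpNorm (f s) 2 volume < ⊤}
    · rw [piecewise_eq_of_mem _ _ _ hs, dist_eq_norm, Lp.norm_def]
      refine congrArg ENNReal.toReal (eLpNorm_congr_ae ?_)
      filter_upwards [coeFn_toL2 ⟨(hfs s).aestronglyMeasurable, hs⟩,
        Lp.coeFn_sub (toL2 (f s)) a] with q hf_q hsub_q
      rw [hsub_q, Pi.sub_apply, hf_q]
    · rw [piecewise_eq_of_notMem _ _ _ hs, toL2_of_not_memLp fun h => hs h.2]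
  rw [hdist]
  exact Measurable.piecewise hS
    (measurable_eLpNorm two_ne_zero ENNReal.ofNat_ne_top hfa).ennreal_toReal measurable_const

/-! ### Multiplication by a bounded potential -/

/-- The kernel `V(x) a(x, y)`: composition of `a` with multiplication by `V` on the left. -/
def mulFst (V : E → ℝ) (a : L2) : L2 := toL2 fun q => (V q.1 : ℂ) * a q

/-- The kernel `V(y) a(x, y)`: composition of `a` with multiplication by `V` on the right. -/
def mulSnd (V : E → ℝ) (a : L2) : L2 := toL2 fun q => (V q.2 : ℂ) * a q

section BoundedPotential

variable {V : E → ℝ} {C : ℝ}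

theorem memLp_ofReal_mul {W : E × E → ℝ} (hW : Measurable W) (hC : ∀ q, |W q| ≤ C) (a : L2) :
    MemLp (fun q => (W q : ℂ) * a q) 2 volume := by
  have ha := (Lp.stronglyMeasurable a).measurable
  refine (Lp.memLp a).of_le_mul (c := C) (Measurable.aestronglyMeasurable (by fun_prop))
    (.of_forall fun q => ?_)
  rw [norm_mul, Complex.norm_real]
  gcongr
  exact hC q

theorem coeFn_mulFst (hV : Measurable V) (hC : ∀ x, |V x| ≤ C) (a : L2) :
    mulFst V a =ᵐ[volume] fun q => (V q.1 : ℂ) * a q :=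
  coeFn_toL2 (memLp_ofReal_mul (hV.comp measurable_fst) (fun q => hC q.1) a)

theorem coeFn_mulSnd (hV : Measurable V) (hC : ∀ x, |V x| ≤ C) (a : L2) :
    mulSnd V a =ᵐ[volume] fun q => (V q.2 : ℂ) * a q :=
  coeFn_toL2 (memLp_ofReal_mul (hV.comp measurable_snd) (fun q => hC q.2) a)

theorem norm_mulFst_le (hV : Measurable V) (hC : ∀ x, |V x| ≤ C) (a : L2) :
    ‖mulFst V a‖ ≤ C * ‖a‖ := by
  refine Lp.norm_le_mul_norm_of_ae_le_mul ?_
  filter_upwards [coeFn_mulFst hV hC a] with q hq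
  rw [hq, norm_mul, Complex.norm_real]
  gcongr
  exact hC q.1

theorem adj_mulFst (hV : Measurable V) (hC : ∀ x, |V x| ≤ C) (a : L2) :
    adj (mulFst V a) = mulSnd V (adj a) := by
  apply Lp.ext
  filter_upwards [coeFn_adj (mulFst V a), ae_swap (coeFn_mulFst hV hC a),
    coeFn_mulSnd hV hC (adj a), coeFn_adj a] with q h₁ h₂ h₃ h₄
  simp [h₁, h₂, h₃, h₄]

theorem adj_mulSnd (hV : Measurable V) (hC : ∀ x, |V x| ≤ C) (a : L2) :
    adj (mulSnd V a) = mulFst V (adj a) := by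
  rw [← adj_adj (mulFst V (adj a)), adj_mulFst hV hC, adj_adj]

theorem comp_mulFst_left (hV : Measurable V) (hC : ∀ x, |V x| ≤ C) (a b : L2) :
    comp (mulFst V a) b = mulFst V (comp a b) := by
  apply Lp.ext
  filter_upwards [comp_ae_eq (coeFn_mulFst hV hC a) (EventuallyEq.refl _ b),
    coeFn_mulFst hV hC (comp a b), coeFn_comp a b] with q h₁ h₂ h₃
  rw [h₁, h₂, h₃]
  simp only [compFun, mul_assoc, integral_const_mul]

theorem comp_mulSnd_left (hV : Measurable V) (hC : ∀ x, |V x| ≤ C) (a b : L2) :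
    comp (mulSnd V a) b = comp a (mulFst V b) := by
  apply Lp.ext
  filter_upwards [comp_ae_eq (coeFn_mulSnd hV hC a) (EventuallyEq.refl _ b),
    comp_ae_eq (EventuallyEq.refl _ a) (coeFn_mulFst hV hC b)] with q h₁ h₂
  rw [h₁, h₂]
  simp only [compFun, mul_assoc, mul_left_comm]

theorem inner_mulFst_left (hV : Measurable V) (hC : ∀ x, |V x| ≤ C) (a b : L2) :
    inner ℂ (mulFst V a) b = inner ℂ a (mulFst V b) := by
  rw [inner_L2, inner_L2]
  refine integral_congr_ae ?_
  filter_upwards [coeFn_mulFst hV hC a, coeFn_mulFst hV hC b] with q h₁ h₂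
  rw [h₁, h₂, star_mul', Complex.star_def, Complex.conj_ofReal]
  ring

theorem inner_mulSnd_left (hV : Measurable V) (hC : ∀ x, |V x| ≤ C) (a b : L2) :
    inner ℂ (mulSnd V a) b = inner ℂ a (mulSnd V b) := by
  rw [← inner_adj_adj b, adj_mulSnd hV hC, ← inner_adj_adj (mulSnd V b), adj_mulSnd hV hC,
    ← inner_conj_symm, inner_mulFst_left hV hC, inner_conj_symm]

theorem mulFst_add (hV : Measurable V) (hC : ∀ x, |V x| ≤ C) (a b : L2) :
    mulFst V (a + b) = mulFst V a + mulFst V b := by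
  apply Lp.ext
  filter_upwards [coeFn_mulFst hV hC (a + b), coeFn_mulFst hV hC a, coeFn_mulFst hV hC b,
    Lp.coeFn_add a b, Lp.coeFn_add (mulFst V a) (mulFst V b)] with q h₁ h₂ h₃ h₄ h₅
  rw [h₁, h₅, Pi.add_apply, h₂, h₃, h₄, Pi.add_apply, mul_add]

theorem continuous_mulFst (hV : Measurable V) (hC : ∀ x, |V x| ≤ C) : Continuous (mulFst V) :=
  AddMonoidHomClass.continuous_of_bound (AddMonoidHom.mk' (mulFst V) (mulFst_add hV hC)) C
    (norm_mulFst_le hV hC)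

end BoundedPotential

section TimeDependentPotential

variable {V : ℝ → E → ℝ} {B : ℝ → ℝ} {a : ℝ → L2} {S : Set ℝ}

theorem aestronglyMeasurable_mulFst {μ : Measure ℝ} (hV : Measurable (Function.uncurry V))
    (hB : ∀ s x, |V s x| ≤ B s) (ha : AEStronglyMeasurable a μ) :
    AEStronglyMeasurable (fun s => mulFst (V s) (a s)) μ := by
  borelize (↥L2)
  have hVs : ∀ s, Measurable (V s) := fun s => hV.comp measurable_prodMk_left
  have hjoint : StronglyMeasurable (Function.uncurry fun (b : L2) (s : ℝ) => mulFst (V s) b) := by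
    refine stronglyMeasurable_uncurry_of_continuous_of_stronglyMeasurable
      (fun s => continuous_mulFst (hVs s) (hB s)) fun b => ?_
    have hVfst : Measurable fun p : ℝ × (E × E) => V p.1 p.2.1 :=
      hV.comp (by fun_prop : Measurable fun p : ℝ × (E × E) => (p.1, p.2.1))
    exact stronglyMeasurable_toL2 (f := fun s q => (V s q.1 : ℂ) * b q)
      ((Complex.measurable_ofReal.comp hVfst).mul
        ((Lp.stronglyMeasurable b).measurable.comp measurable_snd))
  exact (hjoint.comp_measurable (ha.stronglyMeasurable_mk.measurable.prodMk
    measurable_id)).aestronglyMeasurable.congr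
      (ha.ae_eq_mk.mono fun s hs => by simp [Function.uncurry, ← hs])

theorem integrableOn_mulFst (hV : Measurable (Function.uncurry V)) (hB : ∀ s x, |V s x| ≤ B s)
    (hS : IsCompact S) (hB_int : IntegrableOn B S) (ha : ContinuousOn a S) :
    IntegrableOn (fun s => mulFst (V s) (a s)) S :=
  Integrable.mono' (hB_int.mul_continuousOn ha.norm hS)
    (aestronglyMeasurable_mulFst hV hB (ha.aestronglyMeasurable hS.measurableSet))
    (.of_forall fun s => norm_mulFst_le (hV.comp measurable_prodMk_left) (hB s) _)

theorem integrableOn_mulSnd (hV : Measurable (Function.uncurry V)) (hB : ∀ s x, |V s x| ≤ B s)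
    (hS : IsCompact S) (hB_int : IntegrableOn B S) (ha : ContinuousOn a S) :
    IntegrableOn (fun s => mulSnd (V s) (a s)) S := by
  have h := integrableOn_mulFst hV hB hS hB_int (continuous_adj.comp_continuousOn ha)
  refine (adjₗᵢ.toContinuousLinearMap.integrable_comp h).congr (.of_forall fun s => ?_)
  exact (adj_mulFst (hV.comp measurable_prodMk_left) (hB s) _).trans
    (congrArg _ (adj_adj _))

end TimeDependentPotential

/-! ### The coefficients of the equations -/

section Coefficients

variable {v : E → ℝ} {φ : ℝ → E → ℂ} {T : ℝ}

theorem measurable_wFun (hv : Measurable v) (hφ : Measurable (Function.uncurry φ)) :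
    Measurable (Function.uncurry (wFun v φ)) := by
  have hφ_fst : Measurable fun p : ℝ × (E × E) => φ p.1 p.2.1 :=
    hφ.comp (by fun_prop : Measurable fun p : ℝ × (E × E) => (p.1, p.2.1))
  have hφ_snd : Measurable fun p : ℝ × (E × E) => φ p.1 p.2.2 :=
    hφ.comp (by fun_prop : Measurable fun p : ℝ × (E × E) => (p.1, p.2.2))
  have hv_sub : Measurable fun p : ℝ × (E × E) => v (p.2.1 - p.2.2) := hv.comp (by fun_prop)
  exact ((Complex.measurable_ofReal.comp hv_sub).mul hφ_fst).mul
    (continuous_star.measurable.comp hφ_snd)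

theorem norm_wFun (v : E → ℝ) (φ : ℝ → E → ℂ) (t : ℝ) (q : E × E) :
    ‖wFun v φ t q‖ = ‖mFun v φ t q‖ := by
  simp [wFun, mFun]

theorem transpose_toL2 (f : E × E → ℂ) : transpose (toL2 f) = toL2 (f ∘ Prod.swap) := by
  by_cases hf : MemLp f 2 volume
  · apply Lp.ext
    filter_upwards [coeFn_transpose (toL2 f), ae_swap (coeFn_toL2 hf),
      coeFn_toL2 (hf.comp_measurePreserving measurePreserving_swap)] with q h₁ h₂ h₃
    rw [h₁, h₂, h₃, Function.comp_apply]
  · have hf' : ¬ MemLp (f ∘ Prod.swap) 2 volume := fun h =>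
      hf (h.comp_measurePreserving measurePreserving_swap)
    rw [toL2_of_not_memLp hf, toL2_of_not_memLp hf', ← zero_smul ℂ (0 : L2), transpose_smul,
      zero_smul, zero_smul]

theorem star_toL2 (f : E × E → ℂ) : star (toL2 f) = toL2 (star f) := by
  by_cases hf : MemLp f 2 volume
  · apply Lp.ext
    filter_upwards [Lp.coeFn_star (toL2 f), coeFn_toL2 hf, coeFn_toL2 hf.star] with q h₁ h₂ h₃
    rw [h₁, h₃, Pi.star_apply, Pi.star_apply, h₂]
  · have hf' : ¬ MemLp (star f) 2 volume := fun h => hf (star_star f ▸ h.star)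
    rw [toL2_of_not_memLp hf, toL2_of_not_memLp hf', ← norm_le_zero_iff, norm_star_L2,
      norm_zero]

theorem transpose_mKer (hv_even : ∀ x, v (-x) = v x) (t : ℝ) :
    transpose (mKer v φ t) = mKer v φ t := by
  rw [mKer, transpose_toL2]
  congr 1 with q
  simp only [Function.comp_apply, mFun, Prod.fst_swap, Prod.snd_swap]
  rw [← hv_even, neg_sub, mul_right_comm]

theorem adj_mKer (hv_even : ∀ x, v (-x) = v x) (t : ℝ) :
    adj (mKer v φ t) = star (mKer v φ t) :=
  adj_eq_star_of_transpose_eq (transpose_mKer hv_even t)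

theorem adj_wKer (hv_even : ∀ x, v (-x) = v x) (t : ℝ) : adj (wKer v φ t) = wKer v φ t := by
  rw [wKer, adj, transpose_toL2, star_toL2]
  congr 1 with q
  simp only [wFun, Pi.star_apply, Function.comp_apply, Prod.fst_swap, Prod.snd_swap, star_mul',
    Complex.star_def, Complex.conj_ofReal, Complex.conj_conj]
  rw [← hv_even, neg_sub, mul_right_comm]

theorem integrableOn_wKer {S : Set ℝ} (hv : Measurable v) (hφ : Measurable (Function.uncurry φ))
    (hm : ∀ᵐ t ∂(volume.restrict S), MemLp (mFun v φ t) 2 volume)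
    (hm_int : IntegrableOn (mKer v φ) S) : IntegrableOn (wKer v φ) S := by
  have hw := measurable_wFun hv hφ
  refine Integrable.mono hm_int (stronglyMeasurable_toL2 hw).aestronglyMeasurable ?_
  filter_upwards [hm] with t ht
  have hwt : MemLp (wFun v φ t) 2 volume :=
    ht.of_le (hw.comp measurable_prodMk_left).aestronglyMeasurable
      (.of_forall fun q => (norm_wFun v φ t q).le)
  refine Lp.norm_le_norm_of_ae_le ?_
  filter_upwards [coeFn_toL2 ht, coeFn_toL2 hwt] with q h₁ h₂
  rw [wKer, mKer, h₁, h₂, norm_wFun]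

theorem measurable_meanField (hv : Measurable v) (hφ : Measurable (Function.uncurry φ)) :
    Measurable (Function.uncurry (meanField v φ)) := by
  have hφ_snd : Measurable fun p : (ℝ × E) × E => φ p.1.1 p.2 :=
    hφ.comp (by fun_prop : Measurable fun p : (ℝ × E) × E => (p.1.1, p.2))
  have hv_sub : Measurable fun p : (ℝ × E) × E => v (p.1.2 - p.2) := hv.comp (by fun_prop)
  exact (hv_sub.mul (hφ_snd.norm.pow_const 2)).stronglyMeasurable.integral_prod_right'.measurable

theorem exists_bounded_eq_meanField {S : Set ℝ} (hv : Measurable v)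
    (hφ : Measurable (Function.uncurry φ)) (hbdd : ∃ β : ℝ → ℝ, IntegrableOn β S ∧
      ∀ᵐ t ∂(volume.restrict S), ∀ᵐ x : E, |meanField v φ t x| ≤ β t) :
    ∃ (V : ℝ → E → ℝ) (B : ℝ → ℝ), Measurable (Function.uncurry V) ∧ IntegrableOn B S ∧
      (∀ s x, |V s x| ≤ B s) ∧
      ∀ᵐ t ∂(volume.restrict S), ∀ᵐ x : E, meanField v φ t x = V t x := by
  obtain ⟨β, hβ, hle⟩ := hbdd
  have hβ_mk := hβ.1.stronglyMeasurable_mk.measurable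
  have hmf := measurable_meanField hv hφ
  classical
  refine ⟨fun s x => if |meanField v φ s x| ≤ hβ.1.mk β s then meanField v φ s x else 0,
    fun s => |hβ.1.mk β s|, ?_, (hβ.congr hβ.1.ae_eq_mk).abs, fun s x => ?_, ?_⟩
  · exact Measurable.ite (measurableSet_le hmf.norm (hβ_mk.comp measurable_fst)) hmf
      measurable_const
  · dsimp only
    split_ifs with h
    · exact h.trans (le_abs_self _)
    · rw [abs_zero]
      exact abs_nonneg _
  · filter_upwards [hle, hβ.1.ae_eq_mk] with t ht hβt
    filter_upwards [ht] with x hx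
    rw [if_pos (hx.trans_eq hβt)]

end Coefficients

/-! ### Continuity of `ch(k)` -/

open scoped ComplexOrder in
theorem re_inner_comp_nonneg {p : L2} (hp : 0 ≤ compLeft p) (a : L2) :
    0 ≤ (inner ℂ a (comp p a)).re :=
  ((ContinuousLinearMap.nonneg_iff_isPositive _).1 hp).re_inner_nonneg_right a

open scoped ComplexOrder in
theorem norm_sub_le_norm_two_smul_add_comp_self_sub {p r : L2} (hp : 0 ≤ compLeft p)
    (hr : 0 ≤ compLeft r) (hr_adj : adj r = r) :
    ‖p - r‖ ≤ ‖((2 : ℂ) • p + comp p p) - ((2 : ℂ) • r + comp r r)‖ := by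
  have hpr : comp p (p - r) = comp p p - comp p r := (compLeft p).map_sub p r
  have hrp : comp (p - r) r = comp p r - comp r r :=
    congrArg (fun A : L2 →L[ℂ] L2 => A r) (compL.map_sub p r)
  have hD : ((2 : ℂ) • p + comp p p) - ((2 : ℂ) • r + comp r r)
      = (2 : ℂ) • (p - r) + comp p (p - r) + comp (p - r) r := by
    rw [hpr, hrp, smul_sub]
    abel
  rw [hD]
  generalize p - r = d
  have hdr : 0 ≤ (inner ℂ d (comp d r)).re := by
    rw [← inner_adj_adj, adj_comp, hr_adj, ← inner_conj_symm, Complex.conj_re]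
    exact re_inner_comp_nonneg hr _
  have hdd : (inner ℂ d ((2 : ℂ) • d)).re = 2 * ‖d‖ ^ 2 := by
    rw [inner_smul_right, inner_self_eq_norm_sq_to_K]
    simp [← Complex.ofReal_pow]
  have hle : 2 * ‖d‖ ^ 2 ≤ ‖d‖ * ‖(2 : ℂ) • d + comp p d + comp d r‖ := by
    refine le_trans ?_ ((Complex.re_le_norm _).trans (norm_inner_le_norm _ _))
    rw [inner_add_right, inner_add_right, Complex.add_re, Complex.add_re, hdd]
    exact (le_add_of_nonneg_right (re_inner_comp_nonneg hp d)).trans (le_add_of_nonneg_right hdr)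
  rcases (norm_nonneg d).eq_or_lt with hd | hd
  · exact hd ▸ norm_nonneg _
  · exact le_of_mul_le_mul_left (by linarith [sq ‖d‖, sq_nonneg ‖d‖]) hd

theorem norm_chSubOne_sub_le {k l : L2} (hk : transpose k = k) (hl : transpose l = l) :
    ‖chSubOne k - chSubOne l‖
      ≤ ‖comp (sh k) (adj (sh k)) - comp (sh l) (adj (sh l))‖ := by
  rw [← two_smul_chSubOne_add_comp_self hk, ← two_smul_chSubOne_add_comp_self hl]
  exact norm_sub_le_norm_two_smul_add_comp_self_sub (compLeft_chSubOne_nonneg hk)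
    (compLeft_chSubOne_nonneg hl) (adj_chSubOne hl)

theorem continuousOn_chSubOne {k : ℝ → L2} {S : Set ℝ} (hk : ∀ t ∈ S, transpose (k t) = k t)
    (hsh : ContinuousOn (fun t => sh (k t)) S) : ContinuousOn (fun t => chSubOne (k t)) S := by
  have hN : ContinuousOn (fun t => comp (sh (k t)) (adj (sh (k t)))) S :=
    continuousOn_comp hsh (continuous_adj.comp_continuousOn hsh)
  intro t ht
  have h := tendsto_iff_norm_sub_tendsto_zero.1 (hN t ht)
  refine tendsto_iff_norm_sub_tendsto_zero.2 (tendsto_of_tendsto_of_tendsto_of_le_of_le'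
    tendsto_const_nhds h (.of_forall fun _ => norm_nonneg _) ?_)
  filter_upwards [self_mem_nhdsWithin] with s hs using norm_chSubOne_sub_le (hk s hs) (hk t ht)

/-! ### From the weak formulation to the mollified equations -/

/-- The pairing `a ↦ ∫∫ a ψ` with a square-integrable `ψ`, as a continuous linear functional
(junk if `ψ` is not square-integrable). -/
def pairCLM (ψ : E × E → ℂ) : L2 →L[ℂ] ℂ := innerSL ℂ (toL2 (star ψ))

theorem pairCLM_apply {ψ : E × E → ℂ} (h : MemLp ψ 2 volume) (a : L2) :
    pairCLM ψ a = pair a ψ := by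
  rw [pairCLM, innerSL_apply_apply, inner_L2, pair]
  refine integral_congr_ae ?_
  filter_upwards [coeFn_toL2 h.star] with q hq
  rw [hq, Pi.star_apply, star_star]

section WeakFormulation

attribute [local irreducible] pairCLM mollify mollifiedLaplacian comp adj EvenTestFunction.lap
  mulFst mulSnd

variable {T α β σ C : ℝ} {a K G A : ℝ → L2} {f g : EvenTestFunction}

theorem intervalIntegrable_pairCLM (ψ : E × E → ℂ) (ha : IntegrableOn a (Icc 0 T)) {t : ℝ}
    (ht : t ∈ Icc 0 T) : IntervalIntegrable (fun s => pairCLM ψ (a s)) volume 0 t :=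
  intervalIntegrable_of_integrableOn_Icc ((pairCLM ψ).integrable_comp ha) ht

theorem isSchrodinger_of_pair_tensorTest (ha : ContinuousOn a (Icc 0 T))
    (hA : IntegrableOn A (Icc 0 T))
    (h : ∀ f g q, ∀ t ∈ Icc 0 T,
      Complex.I * (pair (a t) (tensorTest f g q) - pair (a 0) (tensorTest f g q))
        = ∫ s in (0 : ℝ)..t, (α * pair (a s) (tensorTest f.lap g q)
          + β * pair (a s) (tensorTest f g.lap q) + pair (A s) (tensorTest f g q))) :
    IsSchrodinger T α β a A where
  continuousOn := ha
  integrableOn_source := hA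
  smul_mollify_sub f g t ht := by
    have ha_int := ha.integrableOn_Icc (μ := volume)
    have ha' := intervalIntegrable_of_integrableOn_Icc ha_int ht
    have hA' := intervalIntegrable_of_integrableOn_Icc hA ht
    have hpair : ∀ q,
        pair (Complex.I • (a t - a 0) - ∫ s in (0 : ℝ)..t, A s) (tensorTest f g q)
          = α * pair (∫ s in (0 : ℝ)..t, a s) (tensorTest f.lap g q)
            + β * pair (∫ s in (0 : ℝ)..t, a s) (tensorTest f g.lap q) := fun q => by
      have hi := fun ψ => intervalIntegrable_pairCLM ψ ha_int ht
      have h' := h f g q t ht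
      simp only [← pairCLM_apply (isTest_tensorTest _ _ q).memLp] at h' ⊢
      rw [intervalIntegral.integral_add (((hi _).const_mul _).add ((hi _).const_mul _))
          (intervalIntegrable_pairCLM _ hA ht),
        intervalIntegral.integral_add ((hi _).const_mul _) ((hi _).const_mul _),
        intervalIntegral.integral_const_mul, intervalIntegral.integral_const_mul,
        (pairCLM _).intervalIntegral_comp_comm ha', (pairCLM _).intervalIntegral_comp_comm ha',
        (pairCLM _).intervalIntegral_comp_comm hA'] at h'
      simp only [map_sub, map_smul, smul_eq_mul, h', add_sub_cancel_right]
    have hmollify := mollify_eq_of_pair_tensorTest_eq hpair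
    simp only [map_sub (mollify f g) (Complex.I • (a t - a 0)), map_smul, sub_eq_iff_eq_add]
      at hmollify
    exact hmollify.trans (by rw [mollifiedLaplacian])

theorem pair_add_mul (a : L2) {V V' : E → ℝ} (hV : Measurable V) (hC : ∀ x, |V x| ≤ C)
    (hV' : ∀ᵐ x, V' x = V x) (σ : ℝ) {ψ : E × E → ℂ} (hψ : MemLp ψ 2 volume) :
    pair a (fun q => ((V' q.1 + σ * V' q.2 : ℝ) : ℂ) * ψ q)
      = pair (mulFst V a) ψ + σ * pair (mulSnd V a) ψ := by
  have hfst : ∀ᵐ q : E × E, V' q.1 = V q.1 := Measure.quasiMeasurePreserving_fst.ae hV'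
  have hsnd : ∀ᵐ q : E × E, V' q.2 = V q.2 := Measure.quasiMeasurePreserving_snd.ae hV'
  have hi : ∀ b : L2, Integrable fun q => b q * ψ q := fun b => (Lp.memLp b).integrable_mul hψ
  rw [pair, pair, pair, ← integral_const_mul, ← integral_add (hi _) ((hi _).const_mul _)]
  refine integral_congr_ae ?_
  filter_upwards [hfst, hsnd, coeFn_mulFst hV hC a, coeFn_mulSnd hV hC a] with q h₁ h₂ h₃ h₄
  rw [h₁, h₂, h₃, h₄]
  push_cast
  ring

theorem pair_neg_lapX_sub_lapY_tensorTest (a : L2) (q : E × E) (σ : ℝ) :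
    pair a (fun z => -lapX (tensorTest f g q) z - σ * lapY (tensorTest f g q) z)
      = -(pair a (tensorTest f.lap g q) + σ * pair a (tensorTest f g.lap q)) := by
  have hi : ∀ f g, Integrable fun z => a z * tensorTest f g q z := fun f g =>
    (Lp.memLp a).integrable_mul (isTest_tensorTest f g q).memLp
  rw [lapX_tensorTest, lapY_tensorTest, pair, pair, pair, ← integral_const_mul,
    ← integral_add (hi _ _) ((hi _ _).const_mul _), ← integral_neg]
  refine integral_congr_ae (.of_forall fun z => ?_)
  dsimp only
  ring

theorem isSchrodinger_of_weak {V V' : ℝ → E → ℝ} {B : ℝ → ℝ}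
    (hV : Measurable (Function.uncurry V)) (hB : ∀ s x, |V s x| ≤ B s)
    (hB_int : IntegrableOn B (Icc 0 T))
    (hV' : ∀ᵐ t ∂(volume.restrict (Icc 0 T)), ∀ᵐ x : E, V' t x = V t x)
    (ha : ContinuousOn a (Icc 0 T)) (hK : IntegrableOn K (Icc 0 T)) (hG : IntegrableOn G (Icc 0 T))
    (h : ∀ ψ : E × E → ℂ, IsTest ψ → ∀ t ∈ Icc 0 T,
      Complex.I * (pair (a t) ψ - pair (a 0) ψ)
        + ∫ s in (0 : ℝ)..t, (pair (a s) (fun q => -lapX ψ q - σ * lapY ψ q) + pair (K s) ψ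
            + pair (a s) (fun q => ((V' s q.1 + σ * V' s q.2 : ℝ) : ℂ) * ψ q))
        = ∫ s in (0 : ℝ)..t, pair (G s) ψ) :
    IsSchrodinger T 1 σ a
      (fun s => G s - K s - mulFst (V s) (a s) - (σ : ℂ) • mulSnd (V s) (a s)) := by
  have hfst := integrableOn_mulFst hV hB isCompact_Icc hB_int ha
  have hsnd := integrableOn_mulSnd hV hB isCompact_Icc hB_int ha
  have hA := ((hG.sub hK).sub hfst).sub (hsnd.smul (σ : ℂ))
  refine isSchrodinger_of_pair_tensorTest ha hA fun f g q t ht => ?_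
  have hψ := (isTest_tensorTest f g q).memLp
  have hψ_fst := (isTest_tensorTest f.lap g q).memLp
  have hψ_snd := (isTest_tensorTest f g.lap q).memLp
  have hi : ∀ (ψ) {b : ℝ → L2}, IntegrableOn b (Icc 0 T) →
      IntervalIntegrable (fun s => pairCLM ψ (b s)) volume 0 t :=
    fun ψ b hb => intervalIntegrable_pairCLM ψ hb ht
  have ha_int := ha.integrableOn_Icc (μ := volume)
  have hpair : ∫ s in (0 : ℝ)..t, (pair (a s)
        (fun z => -lapX (tensorTest f g q) z - σ * lapY (tensorTest f g q) z)
        + pair (K s) (tensorTest f g q)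
        + pair (a s) (fun z => ((V' s z.1 + σ * V' s z.2 : ℝ) : ℂ) * tensorTest f g q z))
      = ∫ s in (0 : ℝ)..t, (-(pairCLM (tensorTest f.lap g q) (a s)
          + σ * pairCLM (tensorTest f g.lap q) (a s)) + pairCLM (tensorTest f g q) (K s)
        + (pairCLM (tensorTest f g q) (mulFst (V s) (a s))
          + σ * pairCLM (tensorTest f g q) (mulSnd (V s) (a s)))) := by
    refine intervalIntegral.integral_congr_ae_restrict ?_
    rw [uIoc_of_le ht.1]
    filter_upwards [ae_restrict_of_ae_restrict_of_subset
      ((Ioc_subset_Icc_self).trans (Icc_subset_Icc_right ht.2)) hV'] with s hs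
    have hVs : Measurable (V s) := hV.comp measurable_prodMk_left
    rw [pair_neg_lapX_sub_lapY_tensorTest, pair_add_mul (a s) hVs (hB s) hs σ hψ, pairCLM_apply hψ,
      pairCLM_apply hψ, pairCLM_apply hψ, pairCLM_apply hψ_fst, pairCLM_apply hψ_snd]
  have h' := h _ (isTest_tensorTest f g q) t ht
  rw [hpair, ← eq_sub_iff_add_eq] at h'
  have h_lap : IntervalIntegrable (fun s => -(pairCLM (tensorTest f.lap g q) (a s)
      + σ * pairCLM (tensorTest f g.lap q) (a s))) volume 0 t :=
    ((hi _ ha_int).add ((hi _ ha_int).const_mul _)).neg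
  simp only [← pairCLM_apply hψ, ← pairCLM_apply hψ_fst, ← pairCLM_apply hψ_snd] at h' ⊢
  rw [h', ← intervalIntegral.integral_sub (hi _ hG)
    ((h_lap.add (hi _ hK)).add ((hi _ hfst).add ((hi _ hsnd).const_mul _)))]
  refine intervalIntegral.integral_congr fun s _ => ?_
  simp only [map_sub, map_smul, smul_eq_mul, Complex.ofReal_one]
  ring

end WeakFormulation

/-- The source `A` for which the equation `S(u) = G`, with mean field `V`, reads
`i u_t - Δ_x u - Δ_y u = A`. -/
def sourceS (V : E → ℝ) (w u G : L2) : L2 :=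
  G - (comp w u + comp u (transpose w)) - (mulFst V u + mulSnd V u)

/-- The source `A` for which the equation `W(p) = F`, with mean field `V`, reads
`i p_t - Δ_x p + Δ_y p = A`. -/
def sourceW (V : E → ℝ) (w p F : L2) : L2 :=
  F - (comp w p - comp p w) - (mulFst V p - mulSnd V p)

section WeakSolutions

attribute [local irreducible] comp mulFst mulSnd

variable {v : E → ℝ} {φ : ℝ → E → ℂ} {T : ℝ} {a G : ℝ → L2} {V : ℝ → E → ℝ} {B : ℝ → ℝ}

theorem IsS.isSchrodinger (h : IsS v φ T a G) (hV : Measurable (Function.uncurry V))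
    (hB : ∀ s x, |V s x| ≤ B s) (hB_int : IntegrableOn B (Icc 0 T))
    (hV_eq : ∀ᵐ t ∂(volume.restrict (Icc 0 T)), ∀ᵐ x : E, meanField v φ t x = V t x)
    (ha : ContinuousOn a (Icc 0 T)) (hw : IntegrableOn (wKer v φ) (Icc 0 T))
    (hG : IntegrableOn G (Icc 0 T)) :
    IsSchrodinger T 1 1 a fun s => sourceS (V s) (wKer v φ s) (a s) (G s) := by
  let τ : L2 →L[ℂ] L2 :=
    (Lp.compMeasurePreservingₗᵢ ℂ Prod.swap measurePreserving_swap).toContinuousLinearMap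
  have hw_transpose : IntegrableOn (fun s => transpose (wKer v φ s)) (Icc 0 T) :=
    τ.integrable_comp hw
  have hK : IntegrableOn (fun s => comp (wKer v φ s) (a s) + comp (a s) (transpose (wKer v φ s)))
      (Icc 0 T) := (integrableOn_comp_left hw ha).add (integrableOn_comp_right ha hw_transpose)
  have hS := isSchrodinger_of_weak (σ := 1) hV hB hB_int hV_eq ha hK hG fun ψ hψ t ht => by
    simpa only [Complex.ofReal_one, one_mul] using h ψ hψ t ht
  simpa only [sourceS, Complex.ofReal_one, one_smul, sub_sub, add_assoc] using hS

theorem IsW.isSchrodinger (h : IsW v φ T a G) (hV : Measurable (Function.uncurry V))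
    (hB : ∀ s x, |V s x| ≤ B s) (hB_int : IntegrableOn B (Icc 0 T))
    (hV_eq : ∀ᵐ t ∂(volume.restrict (Icc 0 T)), ∀ᵐ x : E, meanField v φ t x = V t x)
    (ha : ContinuousOn a (Icc 0 T)) (hw : IntegrableOn (wKer v φ) (Icc 0 T))
    (hG : IntegrableOn G (Icc 0 T)) :
    IsSchrodinger T 1 (-1) a fun s => sourceW (V s) (wKer v φ s) (a s) (G s) := by
  have hK : IntegrableOn (fun s => comp (wKer v φ s) (a s) - comp (a s) (wKer v φ s)) (Icc 0 T) :=
    (integrableOn_comp_left hw ha).sub (integrableOn_comp_right ha hw)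
  have hW := isSchrodinger_of_weak (σ := -1) hV hB hB_int hV_eq ha hK hG fun ψ hψ t ht => by
    simpa only [Complex.ofReal_neg, Complex.ofReal_one, neg_mul, one_mul, sub_neg_eq_add,
      ← sub_eq_add_neg] using h ψ hψ t ht
  simpa only [sourceW, Complex.ofReal_neg, Complex.ofReal_one, neg_smul, one_smul, sub_neg_eq_add,
    ← sub_add] using hW

end WeakSolutions

/-! ### A nonlinear Gronwall inequality -/

section Gronwall

theorem integral_deriv_comp_primitive_mul {h μ : ℝ → ℝ} {a b : ℝ} (hh : ContDiff ℝ 1 h)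
    (hμ : IntervalIntegrable μ volume a b) :
    ∫ s in a..b, deriv h (∫ τ in a..s, μ τ) * μ s = h (∫ τ in a..b, μ τ) - h 0 := by
  have hM : ContinuousOn (fun s => ∫ τ in a..s, μ τ) (uIcc a b) :=
    intervalIntegral.continuousOn_primitive_interval' hμ left_mem_uIcc
  obtain ⟨N, hN⟩ := isCompact_uIcc.exists_bound_of_continuousOn hM
  obtain ⟨C, hC⟩ := (isCompact_closedBall (0 : ℝ) N).exists_bound_of_continuousOn
    (hh.continuous_deriv le_rfl).continuousOn
  have hM_mem : ∀ s ∈ uIcc a b, ∫ τ in a..s, μ τ ∈ Metric.closedBall (0 : ℝ) N := fun s hs =>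
    mem_closedBall_zero_iff.2 (hN s hs)
  have h_int : IntervalIntegrable (fun s => deriv h (∫ τ in a..s, μ τ) * μ s) volume a b :=
    hμ.continuousOn_mul ((hh.continuous_deriv le_rfl).comp_continuousOn hM)
  have hderiv : ∀ᵐ s, s ∈ uIcc a b → HasDerivAt (fun s => h (∫ τ in a..s, μ τ))
      (deriv h (∫ τ in a..s, μ τ) * μ s) s := by
    filter_upwards [hμ.ae_hasDerivAt_integral] with s hs hsI
    exact (hh.differentiable one_ne_zero _).hasDerivAt.comp s (hs hsI a left_mem_uIcc)
  have hlip : ∀ s ∈ uIcc a b, ∀ r ∈ uIcc a b, dist (h (∫ τ in a..s, μ τ)) (h (∫ τ in a..r, μ τ))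
      ≤ C * dist (∫ τ in a..s, ‖μ τ‖) (∫ τ in a..r, ‖μ τ‖) := fun s hs r hr => by
    have hC0 : 0 ≤ C := (norm_nonneg _).trans (hC _ (hM_mem s hs))
    refine le_trans ?_ (mul_le_mul_of_nonneg_left
      (dist_integral_le_dist_integral hμ hμ.norm (fun _ => le_rfl) hs hr) hC0)
    rw [dist_eq_norm, dist_eq_norm]
    exact (convex_closedBall 0 N).norm_image_sub_le_of_norm_deriv_le
      (fun x _ => hh.differentiable one_ne_zero x) hC (hM_mem r hr) (hM_mem s hs)
  rw [integral_eq_sub_of_ae_hasDerivAt_of_dist_le h_int hμ.norm hlip hderiv,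
    intervalIntegral.integral_same]

variable {y μ : ℝ → ℝ} {T c : ℝ}

theorem integral_exp_primitive_mul (hμ : IntervalIntegrable μ volume 0 T) (c : ℝ) :
    ∫ s in (0 : ℝ)..T, 2 * ((c * Real.exp (∫ τ in (0 : ℝ)..s, μ τ) - 1)
        * (c * Real.exp (∫ τ in (0 : ℝ)..s, μ τ))) * μ s
      = (c * Real.exp (∫ s in (0 : ℝ)..T, μ s) - 1) ^ 2 - (c - 1) ^ 2 := by
  have hh : ContDiff ℝ 1 fun x => (c * Real.exp x - 1) ^ 2 :=
    ((contDiff_const.mul Real.contDiff_exp).sub contDiff_const).pow 2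
  have hderiv : ∀ x, deriv (fun x => (c * Real.exp x - 1) ^ 2) x
      = 2 * ((c * Real.exp x - 1) * (c * Real.exp x)) := fun x => by
    refine ((((Real.hasDerivAt_exp x).const_mul c).sub_const 1).pow 2).deriv.trans ?_
    norm_num [mul_assoc]
  simpa only [hderiv, Real.exp_zero, mul_one] using integral_deriv_comp_primitive_mul hh hμ

-- The barrier `c * exp M - 1` solves `(R ^ 2)' = 2 * (R * (1 + R)) * μ`, so `y` cannot reach it.
theorem one_add_lt_mul_exp_of_sq_sub_sq_le (hy : ContinuousOn y (Icc 0 T))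
    (hy0 : ∀ t, 0 ≤ y t) (hμ0 : ∀ t, 0 ≤ μ t) (hμ : IntegrableOn μ (Icc 0 T))
    (h : ∀ t ∈ Icc 0 T, y t ^ 2 - y 0 ^ 2 ≤ ∫ s in (0 : ℝ)..t, 2 * (y s * (1 + y s)) * μ s)
    (hc : 1 + y 0 < c) {t : ℝ} (ht : t ∈ Icc 0 T) :
    1 + y t < c * Real.exp (∫ s in (0 : ℝ)..t, μ s) := by
  have hT : 0 ≤ T := ht.1.trans ht.2
  have hR : ContinuousOn (fun t => c * Real.exp (∫ s in (0 : ℝ)..t, μ s)) (Icc 0 T) := by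
    rw [← uIcc_of_le hT] at hμ ⊢
    exact continuousOn_const.mul
      (intervalIntegral.continuousOn_primitive_interval hμ).rexp
  by_contra! hle
  obtain ⟨r, ⟨hr, hr_le⟩, hr_min⟩ := (isCompact_Icc.of_isClosed_subset
    (isClosed_Icc.isClosed_le hR (hy.const_add 1)) (sep_subset _ _)).exists_isLeast ⟨t, ht, hle⟩
  have hlt : ∀ s ∈ Ioo 0 r, 1 + y s < c * Real.exp (∫ τ in (0 : ℝ)..s, μ τ) := fun s hs =>
    lt_of_not_ge fun hs' => hs.2.not_ge (hr_min ⟨⟨hs.1.le, hs.2.le.trans hr.2⟩, hs'⟩)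
  have hμ' := intervalIntegrable_of_integrableOn_Icc hμ hr
  have hsub : uIcc 0 r ⊆ Icc 0 T := uIcc_of_le hr.1 ▸ Icc_subset_Icc_right hr.2
  have hsq : y r ^ 2 - y 0 ^ 2
      ≤ (c * Real.exp (∫ s in (0 : ℝ)..r, μ s) - 1) ^ 2 - (c - 1) ^ 2 := by
    rw [← integral_exp_primitive_mul hμ']
    refine (h r hr).trans (intervalIntegral.integral_mono_on_of_le_Ioo hr.1
      (hμ'.continuousOn_mul ?_) (hμ'.continuousOn_mul ?_) fun s hs => ?_)
    · exact continuousOn_const.mul ((hy.mul (hy.const_add 1)).mono hsub)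
    · exact continuousOn_const.mul (((hR.sub continuousOn_const).mul hR).mono hsub)
    · have := hy0 s
      have := hμ0 s
      gcongr 2 * (?_ * ?_) * _ <;> linarith [hlt s hs]
  have hR_ge : 1 ≤ c * Real.exp (∫ s in (0 : ℝ)..r, μ s) := one_le_mul_of_one_le_of_one_le
    (by linarith [hy0 0])
    (Real.one_le_exp (intervalIntegral.integral_nonneg hr.1 fun s _ => hμ0 s))
  nlinarith [hy0 0, hy0 r]

theorem one_add_le_mul_exp_of_sq_sub_sq_le (hT : 0 ≤ T) (hy : ContinuousOn y (Icc 0 T))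
    (hy0 : ∀ t, 0 ≤ y t) (hμ0 : ∀ t, 0 ≤ μ t) (hμ : IntegrableOn μ (Icc 0 T))
    (h : ∀ t ∈ Icc 0 T, y t ^ 2 - y 0 ^ 2 ≤ ∫ s in (0 : ℝ)..t, 2 * (y s * (1 + y s)) * μ s) :
    1 + y T ≤ (1 + y 0) * Real.exp (∫ s in (0 : ℝ)..T, μ s) := by
  rw [← div_le_iff₀ (Real.exp_pos _)]
  refine le_of_forall_gt_imp_ge_of_dense fun c hc => ?_
  rw [div_le_iff₀ (Real.exp_pos _)]
  exact (one_add_lt_mul_exp_of_sq_sub_sq_le hy hy0 hμ0 hμ h hc (right_mem_Icc.2 hT)).le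

end Gronwall

/-! ### Self-adjointness of `(F + u m̄)(1 + p)⁻¹` -/

section StarRing

variable {R : Type*} [Ring R] [StarRing R] {h h' p u c m F G P Q : R}

theorem star_eq_neg_of_eq_sub_commutator (hh : star h = h) (hp : star p = p)
    (hP : P = F - (h * p - p * h)) (hP_star : P = -star P) : star F = -F := by
  have hF : F = P + (h * p - p * h) := by rw [hP, sub_add_cancel]
  rw [hF, star_add, star_sub, star_mul, star_mul, hh, hp, ← neg_eq_iff_eq_neg.2 hP_star]
  abel

theorem anticommutator_eq_of_mul_self_eq (hh : star h = h) (hh' : star h' = h')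
    (hcc : c * c = 1 + u * star u) (hP : P = F - (h * c - c * h)) (hQ : Q = G - (h * u + u * h'))
    (hPQ : P * c + c * P = Q * star u - u * star Q) :
    F * c + c * F = G * star u - u * star G := by
  have hQ_star : star Q = star G - (star u * h + h' * star u) := by
    rw [hQ, star_sub, star_add, star_mul, star_mul, hh, hh']
  rw [hQ_star, hP, hQ] at hPQ
  linear_combination (norm := noncomm_ring) hPQ + h * hcc - hcc * h

theorem star_eq_self_of_anticommutator_eq (hc_unit : IsUnit c) (hc : star c = c)
    (hcc : c * c = 1 + u * star u) (hF : star F = -F)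
    (hFG : F * c + c * F = G * star u - u * star G)
    (hG : G - c * m = (F + u * star m) * (Ring.inverse c * u)) :
    star ((F + u * star m) * Ring.inverse c) = (F + u * star m) * Ring.inverse c := by
  obtain ⟨A, hA⟩ : ∃ A, A = (F + u * star m) * Ring.inverse c := ⟨_, rfl⟩
  have hAc : A * c = F + u * star m := by rw [hA, Ring.inverse_mul_cancel_right _ _ hc_unit]
  have hG_eq : G = c * m + A * u := by rw [hA, mul_assoc, ← hG, add_sub_cancel]
  have hAc_star : c * star A = -F + m * star u := by
    simpa only [star_mul, star_add, star_star, hc, hF] using congrArg star hAc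
  have hG_star : star G = star m * c + star u * star A := by
    rw [hG_eq, star_add, star_mul, star_mul, hc]
  rw [hG_star, hG_eq] at hFG
  rw [← hA]
  linear_combination (norm := noncomm_ring) -hFG + A * hcc - hcc * star A - hAc * c + c * hAc_star

end StarRing

theorem norm_le_one_add_norm_of_mul_self_eq {R : Type*} [NormedRing R] [StarRing R] [CStarRing R]
    {c u : R} (hc : star c = c) (hcc : c * c = 1 + u * star u) : ‖c‖ ≤ 1 + ‖u‖ := by
  have h_one : ‖(1 : R)‖ ≤ 1 := by
    rcases subsingleton_or_nontrivial R with _ | _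
    · rw [Subsingleton.elim (1 : R) 0, norm_zero]
      exact zero_le_one
    · exact CStarRing.norm_one.le
  refine le_of_sq_le_sq ?_ (by positivity)
  calc ‖c‖ ^ 2 = ‖1 + u * star u‖ := by rw [sq, ← CStarRing.norm_star_mul_self, hc, hcc]
    _ ≤ 1 + ‖u‖ * ‖u‖ := by
      rw [← CStarRing.norm_self_mul_star]
      exact (norm_add_le _ _).trans (by gcongr)
    _ ≤ (1 + ‖u‖) ^ 2 := by nlinarith [norm_nonneg u]

section FixedTime

variable {V : E → ℝ} {C : ℝ} {k w p u m F G : L2}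

theorem compLeft_sub (a b : L2) : compLeft (a - b) = compLeft a - compLeft b := compL.map_sub a b

theorem compLeft_neg (a : L2) : compLeft (-a) = -compLeft a := compL.map_neg a

theorem norm_compLeft_le (a : L2) : ‖compLeft a‖ ≤ ‖a‖ :=
  ContinuousLinearMap.opNorm_le_bound _ (norm_nonneg a) (norm_comp_le a)

theorem one_add_compLeft_apply (a b : L2) : (1 + compLeft a) b = b + comp a b := rfl

theorem compLeft_mul_inverse_apply (a p u : L2) :
    (compLeft a * Ring.inverse (1 + compLeft p)) u = comp a (invOneAdd p u) := rfl

attribute [local irreducible] comp adj compLeft mulFst mulSnd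

theorem adj_transpose_of_adj_eq (hw : adj w = w) : adj (transpose w) = transpose w := by
  rw [adj, transpose_transpose]
  nth_rw 1 [← hw]
  rw [adj, star_star]

theorem mulFst_smul (hV : Measurable V) (hC : ∀ x, |V x| ≤ C) (r : ℂ) (a : L2) :
    mulFst V (r • a) = r • mulFst V a := by
  apply Lp.ext
  filter_upwards [coeFn_mulFst hV hC (r • a), coeFn_mulFst hV hC a, Lp.coeFn_smul r a,
    Lp.coeFn_smul r (mulFst V a)] with q h_smul h h_coe h_coe'
  rw [h_smul, h_coe', Pi.smul_apply, h, h_coe, Pi.smul_apply, smul_eq_mul, smul_eq_mul,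
    mul_left_comm]

/-- Multiplication by `V(x)` as a bounded operator on kernels; it plays the role of the operator
`V(x)δ(x - y)`. -/
def mulFstCLM (hV : Measurable V) (hC : ∀ x, |V x| ≤ C) : L2 →L[ℂ] L2 :=
  LinearMap.mkContinuous
    { toFun := mulFst V
      map_add' := mulFst_add hV hC
      map_smul' := mulFst_smul hV hC }
    C (norm_mulFst_le hV hC)

theorem mulFstCLM_apply (hV : Measurable V) (hC : ∀ x, |V x| ≤ C) (a : L2) :
    mulFstCLM hV hC a = mulFst V a := rfl

theorem isSelfAdjoint_mulFstCLM (hV : Measurable V) (hC : ∀ x, |V x| ≤ C) :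
    IsSelfAdjoint (mulFstCLM hV hC) :=
  ContinuousLinearMap.isSelfAdjoint_iff_isSymmetric.2 (inner_mulFst_left hV hC)

theorem compLeft_mulFst (hV : Measurable V) (hC : ∀ x, |V x| ≤ C) (a : L2) :
    compLeft (mulFst V a) = mulFstCLM hV hC * compLeft a := by
  ext1 b
  rw [mul_apply_eq_comp, compLeft_apply, compLeft_apply, mulFstCLM_apply, comp_mulFst_left hV hC]

theorem compLeft_mulSnd (hV : Measurable V) (hC : ∀ x, |V x| ≤ C) (a : L2) :
    compLeft (mulSnd V a) = compLeft a * mulFstCLM hV hC := by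
  ext1 b
  rw [mul_apply_eq_comp, compLeft_apply, compLeft_apply, mulFstCLM_apply, comp_mulSnd_left hV hC]

theorem compLeft_sourceW (hV : Measurable V) (hC : ∀ x, |V x| ≤ C) (w p F : L2) :
    compLeft (sourceW V w p F) = compLeft F
      - ((compLeft w + mulFstCLM hV hC) * compLeft p
        - compLeft p * (compLeft w + mulFstCLM hV hC)) := by
  simp only [sourceW, compLeft_sub, compLeft_comp, compLeft_mulFst hV hC, compLeft_mulSnd hV hC]
  noncomm_ring

theorem compLeft_sourceS (hV : Measurable V) (hC : ∀ x, |V x| ≤ C) (w u G : L2) :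
    compLeft (sourceS V w u G) = compLeft G
      - ((compLeft w + mulFstCLM hV hC) * compLeft u
        + compLeft u * (compLeft (transpose w) + mulFstCLM hV hC)) := by
  simp only [sourceS, compLeft_sub, compLeft_add, compLeft_comp, compLeft_mulFst hV hC,
    compLeft_mulSnd hV hC]
  noncomm_ring

theorem isSelfAdjoint_compLeft_add_mulFstCLM (hV : Measurable V) (hC : ∀ x, |V x| ≤ C)
    (hw : adj w = w) : IsSelfAdjoint (compLeft w + mulFstCLM hV hC) :=
  (isSelfAdjoint_compLeft hw).add (isSelfAdjoint_mulFstCLM hV hC)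

attribute [local irreducible] sourceS sourceW mulFstCLM

theorem star_compLeft_eq_neg_of_sourceW (hV : Measurable V) (hC : ∀ x, |V x| ≤ C)
    (hw : adj w = w) (hp : adj p = p) (h : sourceW V w p F = -adj (sourceW V w p F)) :
    star (compLeft F) = -compLeft F := by
  refine star_eq_neg_of_eq_sub_commutator (isSelfAdjoint_compLeft_add_mulFstCLM hV hC hw)
    (isSelfAdjoint_compLeft hp) (compLeft_sourceW hV hC w p F) ?_
  rw [← compLeft_adj, ← compLeft_neg, ← h]

theorem star_one_add_compLeft (hp : adj p = p) : star (1 + compLeft p) = 1 + compLeft p :=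
  (IsSelfAdjoint.one _).add (isSelfAdjoint_compLeft hp)

theorem one_add_compLeft_mul_self (h : (2 : ℝ) • p + comp p p = comp u (adj u)) :
    (1 + compLeft p) * (1 + compLeft p) = 1 + compLeft u * star (compLeft u) := by
  have h_op := congrArg compLeft h
  simp only [two_smul, compLeft_add, compLeft_comp, compLeft_adj] at h_op
  linear_combination (norm := noncomm_ring) h_op

theorem anticommutator_compLeft_eq (hV : Measurable V) (hC : ∀ x, |V x| ≤ C) (hw : adj w = w)
    (hpu : (2 : ℝ) • p + comp p p = comp u (adj u))
    (h : sourceW V w p F + sourceW V w p F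
        + (comp (sourceW V w p F) p + comp p (sourceW V w p F))
      = comp (sourceS V w u G) (adj u) + comp u (-adj (sourceS V w u G))) :
    compLeft F * (1 + compLeft p) + (1 + compLeft p) * compLeft F
      = compLeft G * star (compLeft u) - compLeft u * star (compLeft G) := by
  refine anticommutator_eq_of_mul_self_eq (P := compLeft (sourceW V w p F)) 
    (isSelfAdjoint_compLeft_add_mulFstCLM hV hC hw)
    (isSelfAdjoint_compLeft_add_mulFstCLM hV hC (adj_transpose_of_adj_eq hw))
    (one_add_compLeft_mul_self hpu) ?_ (compLeft_sourceS hV hC w u G) ?_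
  · rw [compLeft_sourceW hV hC]
    noncomm_ring
  · have h_op := congrArg compLeft h
    simp only [compLeft_add, compLeft_comp, compLeft_neg, compLeft_adj] at h_op
    linear_combination (norm := noncomm_ring) h_op

theorem compLeft_invOneAdd (hp : IsUnit (1 + compLeft p)) (u : L2) :
    compLeft (invOneAdd p u) = Ring.inverse (1 + compLeft p) * compLeft u := by
  have h_apply : invOneAdd p u + comp p (invOneAdd p u) = u := by
    rw [← one_add_compLeft_apply, invOneAdd, ← mul_apply_eq_comp, Ring.mul_inverse_cancel _ hp,
      one_apply_eq_self]
  have h_op : (1 + compLeft p) * compLeft (invOneAdd p u) = compLeft u := by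
    rw [add_mul, one_mul, ← compLeft_comp, ← compLeft_add, h_apply]
  rw [← h_op, Ring.inverse_mul_cancel_left _ _ hp]

theorem isSelfAdjoint_compLeft_mul_inverse (hk : transpose k = k) (hm : adj m = star m)
    (hF : star (compLeft F) = -compLeft F)
    (hFG : compLeft F * (1 + compLeft (chSubOne k)) + (1 + compLeft (chSubOne k)) * compLeft F
      = compLeft G * star (compLeft (sh k)) - compLeft (sh k) * star (compLeft G))
    (hG : G - (m + comp (chSubOne k) m)
      = comp (F + comp (sh k) (star m)) (invOneAdd (chSubOne k) (sh k))) :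
    IsSelfAdjoint (compLeft (F + comp (sh k) (star m))
      * Ring.inverse (1 + compLeft (chSubOne k))) := by
  have hc := isUnit_one_add_compLeft_chSubOne hk
  have hX : compLeft (F + comp (sh k) (star m))
      = compLeft F + compLeft (sh k) * star (compLeft m) := by
    simp only [compLeft_add, compLeft_comp, ← compLeft_adj, hm]
  have hG_op : compLeft G - (1 + compLeft (chSubOne k)) * compLeft m
      = (compLeft F + compLeft (sh k) * star (compLeft m))
        * (Ring.inverse (1 + compLeft (chSubOne k)) * compLeft (sh k)) := by
    have h_op := congrArg compLeft hG
    simp only [compLeft_sub, compLeft_add m, compLeft_comp (chSubOne k), compLeft_comp (F + _),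
      compLeft_invOneAdd hc, hX] at h_op
    simpa only [add_mul _ _ (compLeft m), one_mul] using h_op
  simp only [hX]
  exact star_eq_self_of_anticommutator_eq hc (star_one_add_compLeft (adj_chSubOne hk))
    (one_add_compLeft_mul_self (two_smul_chSubOne_add_comp_self hk)) hF hFG hG_op

theorem im_inner_sh_eq (hk : transpose k = k) (hm : adj m = star m)
    (hF : star (compLeft F) = -compLeft F)
    (hFG : compLeft F * (1 + compLeft (chSubOne k)) + (1 + compLeft (chSubOne k)) * compLeft F
      = compLeft G * star (compLeft (sh k)) - compLeft (sh k) * star (compLeft G))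
    (hG : G - (m + comp (chSubOne k) m)
      = comp (F + comp (sh k) (star m)) (invOneAdd (chSubOne k) (sh k))) :
    (inner ℂ (sh k) G).im = (inner ℂ (sh k) (m + comp (chSubOne k) m)).im := by
  have h_im := (isSelfAdjoint_compLeft_mul_inverse hk hm hF hFG hG).isSymmetric.im_inner_self_apply
    (sh k)
  rw [ContinuousLinearMap.coe_coe, compLeft_mul_inverse_apply, ← hG, inner_sub_right] at h_im
  exact sub_eq_zero.1 h_im

theorem norm_one_add_compLeft_chSubOne_le (hk : transpose k = k) :
    ‖1 + compLeft (chSubOne k)‖ ≤ 1 + ‖sh k‖ :=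
  (norm_le_one_add_norm_of_mul_self_eq (star_one_add_compLeft (adj_chSubOne hk))
    (one_add_compLeft_mul_self (two_smul_chSubOne_add_comp_self hk))).trans
      (add_le_add_right (norm_compLeft_le (sh k)) 1)

theorem im_inner_sourceS (hV : Measurable V) (hC : ∀ x, |V x| ≤ C) (hw : adj w = w) (u G : L2) :
    (inner ℂ u (sourceS V w u G)).im = (inner ℂ u G).im := by
  have im_eq_zero : ∀ b : L2, inner ℂ b u = inner ℂ u b → (inner ℂ u b).im = 0 := fun b hb => by
    rw [← Complex.conj_eq_iff_im, inner_conj_symm, hb]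
  have h_left := im_eq_zero (comp w u) (by rw [inner_comp_left, hw])
  have h_right := im_eq_zero (comp u (transpose w)) (by
    rw [inner_comp_right, adj_transpose_of_adj_eq hw])
  have h_fst := im_eq_zero (mulFst V u) (inner_mulFst_left hV hC u u)
  have h_snd := im_eq_zero (mulSnd V u) (inner_mulSnd_left hV hC u u)
  simp only [sourceS, inner_sub_right, inner_add_right, Complex.sub_im, Complex.add_im, h_left,
    h_right, h_fst, h_snd, add_zero, sub_zero]

theorem im_inner_sourceS_le (hV : Measurable V) (hC : ∀ x, |V x| ≤ C) (hk : transpose k = k)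
    (hm : adj m = star m) (hw : adj w = w)
    (hW : sourceW V w (chSubOne k) F = -adj (sourceW V w (chSubOne k) F))
    (hWS : sourceW V w (chSubOne k) F + sourceW V w (chSubOne k) F
        + (comp (sourceW V w (chSubOne k) F) (chSubOne k)
          + comp (chSubOne k) (sourceW V w (chSubOne k) F))
      = comp (sourceS V w (sh k) G) (adj (sh k)) + comp (sh k) (-adj (sourceS V w (sh k) G)))
    (hG : G - (m + comp (chSubOne k) m)
      = comp (F + comp (sh k) (star m)) (invOneAdd (chSubOne k) (sh k))) :
    (inner ℂ (sh k) (sourceS V w (sh k) G)).im ≤ ‖sh k‖ * (1 + ‖sh k‖) * ‖m‖ := by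
  have hF := star_compLeft_eq_neg_of_sourceW hV hC hw (adj_chSubOne hk) hW
  have hFG := anticommutator_compLeft_eq hV hC hw (two_smul_chSubOne_add_comp_self hk) hWS
  calc (inner ℂ (sh k) (sourceS V w (sh k) G)).im
      = (inner ℂ (sh k) ((1 + compLeft (chSubOne k)) m)).im := by
        rw [im_inner_sourceS hV hC hw, im_inner_sh_eq hk hm hF hFG hG, one_add_compLeft_apply]
    _ ≤ ‖sh k‖ * ‖(1 + compLeft (chSubOne k)) m‖ :=
        (Complex.im_le_norm _).trans (norm_inner_le_norm _ _)
    _ ≤ ‖sh k‖ * ((1 + ‖sh k‖) * ‖m‖) := by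
        gcongr
        exact ContinuousLinearMap.le_of_opNorm_le _ (norm_one_add_compLeft_chSubOne_le hk) m
    _ = ‖sh k‖ * (1 + ‖sh k‖) * ‖m‖ := (mul_assoc _ _ _).symm

end FixedTime

/-! ### The energy inequality -/

section EnergyInequality

attribute [local irreducible] comp adj sourceS sourceW

variable {v : E → ℝ} {φ : ℝ → E → ℂ} {T t : ℝ} {k : ℝ → L2} {V : ℝ → E → ℝ} {B : ℝ → ℝ}
  {F G : ℝ → L2}

theorem ae_im_inner_sourceS_le (hv_even : ∀ x, v (-x) = v x) (hV : ∀ s, Measurable (V s))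
    (hB : ∀ s x, |V s x| ≤ B s) (hk : ∀ t ∈ Icc 0 T, transpose (k t) = k t)
    (hp : IsSchrodinger T 1 (-1) (fun t => chSubOne (k t))
      fun t => sourceW (V t) (wKer v φ t) (chSubOne (k t)) (F t))
    (hu : IsSchrodinger T 1 1 (fun t => sh (k t))
      fun t => sourceS (V t) (wKer v φ t) (sh (k t)) (G t))
    (heq : ∀ᵐ t ∂(volume.restrict (Icc 0 T)),
      G t - (mKer v φ t + comp (chSubOne (k t)) (mKer v φ t))
        = comp (F t + comp (sh (k t)) (star (mKer v φ t)))
            (invOneAdd (chSubOne (k t)) (sh (k t)))) :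
    ∀ᵐ t ∂(volume.restrict (Icc 0 T)),
      (inner ℂ (sh (k t)) (sourceS (V t) (wKer v φ t) (sh (k t)) (G t))).im
        ≤ ‖sh (k t)‖ * (1 + ‖sh (k t)‖) * ‖mKer v φ t‖ := by
  have hp_neg_neg : IsSchrodinger T (- -1) (-1) (fun t => chSubOne (k t))
      fun t => sourceW (V t) (wKer v φ t) (chSubOne (k t)) (F t) := by
    rwa [neg_neg]
  have hp_adjoint := hp_neg_neg.adjoint
  rw [neg_neg] at hp_adjoint
  have h_skew := hp.ae_eq hp_adjoint fun t ht => (adj_chSubOne (hk t ht)).symm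
  have h_square := ((hp.add hp).add (hp.comp hp_neg_neg)).ae_eq (hu.comp hu.adjoint) fun t ht => by
    rw [← two_smul_chSubOne_add_comp_self (hk t ht), two_smul]
  filter_upwards [h_skew, h_square, heq, ae_restrict_mem measurableSet_Icc]
    with t h_skew h_square heq ht
  exact im_inner_sourceS_le (hV t) (hB t) (hk t ht) (adj_mKer hv_even t) (adj_wKer hv_even t)
    h_skew h_square heq

theorem IsSchrodinger.norm_sq_sub_le {α β : ℝ} {a A : ℝ → L2} {f : ℝ → ℝ}
    (ha : IsSchrodinger T α β a A) (hf : IntegrableOn f (Icc 0 T))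
    (hle : ∀ᵐ t ∂(volume.restrict (Icc 0 T)), (inner ℂ (a t) (A t)).im ≤ f t) (ht : t ∈ Icc 0 T) :
    ‖a t‖ ^ 2 - ‖a 0‖ ^ 2 ≤ ∫ s in (0 : ℝ)..t, 2 * f s := by
  have h_inner : IntegrableOn (fun s => (inner ℂ (a s) (A s)).im) (Icc 0 T) := by
    simpa only [ContinuousLinearMap.flip_apply, Pi.smul_apply, reInner_neg_I_smul] using
      integrableOn_bilinear_continuousOn reInner.flip isCompact_Icc
        (ha.integrableOn_source.smul (-Complex.I)) ha.continuousOn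
  rw [ha.norm_sq_sub ht, intervalIntegral.integral_const_mul]
  refine mul_le_mul_of_nonneg_left (intervalIntegral.integral_mono_ae_restrict ht.1
    (intervalIntegrable_of_integrableOn_Icc h_inner ht)
    (intervalIntegrable_of_integrableOn_Icc hf ht) ?_) zero_le_two
  exact ae_restrict_of_ae_restrict_of_subset (Icc_subset_Icc_right ht.2) hle

end EnergyInequality

theorem le_add_mul_exp_of_one_add_le {x y M : ℝ} (h : 1 + y ≤ (1 + x) * Real.exp M) :
    y ≤ (M + x) * Real.exp M := by
  have h_exp : (1 - M) * Real.exp M ≤ 1 :=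
    calc (1 - M) * Real.exp M ≤ Real.exp (-M) * Real.exp M := by
          gcongr
          exact Real.one_sub_le_exp_neg M
      _ = 1 := by rw [← Real.exp_add, neg_add_cancel, Real.exp_zero]
  linarith

end PairExcitation

end

theorem theorem5 (v : E → ℝ) (hv : Measurable v) (hv_even : ∀ x, v (-x) = v x)
    (φ : ℝ → E → ℂ) (hφ : Measurable (Function.uncurry φ))
    (T : ℝ) (hT : 0 ≤ T)
    (hm : ∀ᵐ t ∂(volume.restrict (Icc 0 T)), MemLp (mFun v φ t) 2 volume)
    (hm_int : IntegrableOn (mKer v φ) (Icc 0 T))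
    (hV : ∀ᵐ t ∂(volume.restrict (Icc 0 T)), ∀ᵐ x : E,
      Integrable fun y => v (x - y) * ‖φ t y‖ ^ 2)
    (hV_bdd : ∃ β : ℝ → ℝ, IntegrableOn β (Icc 0 T) ∧
      ∀ᵐ t ∂(volume.restrict (Icc 0 T)), ∀ᵐ x : E, |meanField v φ t x| ≤ β t)
    (k : ℝ → L2) (hk : IsSolution v φ T k) :
    ‖sh (k T)‖ ≤ ((∫ t in (0 : ℝ)..T, ‖mKer v φ t‖) + ‖sh (k 0)‖) *
      Real.exp (∫ t in (0 : ℝ)..T, ‖mKer v φ t‖) := by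
  obtain ⟨F, G, hF, hG, hW, hS, heq⟩ := hk.eqn
  obtain ⟨V, B, hV_meas, hB_int, hB, hV_eq⟩ := exists_bounded_eq_meanField hv hφ hV_bdd
  have hw := integrableOn_wKer hv hφ hm hm_int
  have hu := hS.isSchrodinger hV_meas hB hB_int hV_eq hk.cont hw hG
  have hp := hW.isSchrodinger hV_meas hB hB_int hV_eq (continuousOn_chSubOne hk.symm hk.cont) hw hF
  have h_im := ae_im_inner_sourceS_le hv_even (fun s => hV_meas.comp measurable_prodMk_left) hB
    hk.symm hp hu heq
  have h_int : IntegrableOn (fun t => ‖sh (k t)‖ * (1 + ‖sh (k t)‖) * ‖mKer v φ t‖) (Icc 0 T) :=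
    IntegrableOn.continuousOn_mul (hk.cont.norm.mul (continuousOn_const.add hk.cont.norm))
      hm_int.norm isCompact_Icc
  have h_energy : ∀ t ∈ Icc 0 T, ‖sh (k t)‖ ^ 2 - ‖sh (k 0)‖ ^ 2
      ≤ ∫ s in (0 : ℝ)..t, 2 * (‖sh (k s)‖ * (1 + ‖sh (k s)‖)) * ‖mKer v φ s‖ := fun t ht => by
    simpa only [mul_assoc] using hu.norm_sq_sub_le h_int h_im ht
  exact le_add_mul_exp_of_one_add_le (one_add_le_mul_exp_of_sq_sub_sq_le hT hk.cont.norm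
    (fun _ => norm_nonneg _) (fun _ => norm_nonneg _) hm_int.norm h_energy)
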